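/- For $x>0$, $y\in\mathbb R$ put $r_1^2=4+x^2+4x^2y^2$, $\Delta=((x+2)^2+8x^2y^2)((x-2)^2+8x^2y^2)$ and $\omega_\pm=\dfrac{-4+x^2\pm\sqrt\Delta}{2r_1^2}$; these are the two eigenvalues of the bottom $2\times2$ block of the tridiagonal symmetric matrix with spectrum $\{-1,0,1\}$ and bidiagonal coordinates $(x,y)$. Let $R=\{(x,y): x>0,\ 4-4y^2-x^2y^2-8x^2y^4\ge 0\}$, $R_+=R\cap\{x\le 2\}$ and $p_0=(2,0)$. Let $$\mathbf W_\pm(x,y)=\Big(\tfrac{1+\omega_\pm}{1-\omega_\pm}\,x,\ \tfrac{|\omega_\pm|}{1+\omega_\pm}\,y\Big).$$ Wilkinson's step $\mathbf W$ is $\mathbf W_+$ for $x<2$ and $\mathbf W_-$ for $x>2$, it fixes $p_0$, and it is undefined at the other points of the line $r=\{x=2\}$. Let $\mathcal X$ be the set of $z_0\in R$ whose orbit $z_{k+1}=\mathbf W(z_k)$ is defined in $R$ for all $k$ and converges to $p_0$. The sign sequence of $z_0$ is $s\in\mathcal S=\{\pm1\}^{\mathbb N}$ with $s_k=+1$ if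 and only if $z_k\in R_+$. For $0<a\le 1/10$ the wedge of height $a$ is $V_a=\{|x-2|/10\le|y|\le a\}$; its NW and NE faces are the segments $\{x=2-10y,\ 0<y\le a\}$ and $\{x=2+10y,\ 0<y\le a\}$. An $L$-flat arc in $V_a$ is the graph, contained in $V_a$, of an $L$-Lipschitz function on a compact interval. A nonempty closed subset of such an arc is a Cantor set if it has empty interior in the arc and no isolated points. Say that $(L,a)$ has the stretching property if for every $L$-flat arc $\Gamma^+$ in $V_a$ with left endpoint on the NW face and right endpoint on $r$, the image $\mathbf W_+(\Gamma^+)$ contains an $L$-flat arc $\Gamma_1$ in $V_a$ with left endpoint on the NW face and right endpoint on the NE face, such that $\max_{\Gamma_1}y<\frac14\min_{\Gamma^+}y$ and such that, on the part of $\Gamma^+$ between preimages of the endpoints of $\Gamma_1$, $\mathbf W_+$ expands horizontal distances by a factor at least some $\kappa>1$; and if the same holds for $\mathbf W_-$ and every $L$-flat arc in $V_a$ with left endpoint on $r$ and right endpoint on the NE face. **Proposition 5.4.** There are constants $0<L^*<1/6$ and $0<a_0\le 1/10$ such that, for every $0<a^*\le a_0$, the pair $(L^*,a^*)$ has the stretching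 property and the following hold. 1. For every $L^*$-flat arc $\Gamma_0$ in $V_{a^*}$ with left endpoint on the NW face and right endpoint on the NE face, $\mathcal X\cap\Gamma_0$ is a Cantor set, and the map taking $z_0$ to its sign sequence is a bijection from $\mathcal X\cap\Gamma_0$ onto $\mathcal S$. 2. There are Lipschitz functions $f_s:[0,a^*]\to\mathbb R$, $s\in\mathcal S$, such that for $0<y_0\le a^*$ the number $f_s(y_0)$ is the $x$-coordinate of the unique point of $\mathcal X$ on the line $y=y_0$ with sign sequence $s$; the set $\mathcal X\cap\{0\le y\le a^*\}$ is the union of the graphs $\{(f_s(y),y):0\le y\le a^*\}$; and the graphs for two different sign sequences meet only at $p_0$. -/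

import Mathlib

open Set Filter Topology
open scoped NNReal

/-! Wilkinson's shift iteration on `3 × 3` tridiagonal symmetric matrices with spectrum
`{-1, 0, 1}`, in bidiagonal coordinates `(x, y)`. -/

namespace Wilkinson

noncomputable section

/-- The quantity `r₁²`. -/
def r1sq (x y : ℝ) : ℝ := 4 + x ^ 2 + 4 * x ^ 2 * y ^ 2

/-- The quantity `r₂²`. -/
def r2sq (x y : ℝ) : ℝ := 4 + 4 * y ^ 2 + x ^ 2 * y ^ 2

/-- The bottom `2 × 2` block of the tridiagonal symmetric matrix `T` with spectrum `{-1, 0, 1}`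
whose bidiagonal coordinates are `(x, y)`. -/
def bottomBlock (x y : ℝ) : Matrix (Fin 2) (Fin 2) ℝ :=
  (1 / (r1sq x y * r2sq x y)) •
    !![-4 * (x ^ 2 - 4) * (x ^ 2 * y ^ 4 - 1), 2 * y * √(r1sq x y) ^ 3;
       2 * y * √(r1sq x y) ^ 3, y ^ 2 * (x ^ 2 - 4) * r1sq x y]

/-- The discriminant `Δ` (up to the positive factor `r₁⁴`) of the characteristic polynomial of
the bottom block. -/
def disc (x y : ℝ) : ℝ :=
  ((x + 2) ^ 2 + 8 * x ^ 2 * y ^ 2) * ((x - 2) ^ 2 + 8 * x ^ 2 * y ^ 2)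

/-- The larger eigenvalue of the bottom block. -/
def omegaPlus (x y : ℝ) : ℝ := (-4 + x ^ 2 + √(disc x y)) / (2 * r1sq x y)

/-- The smaller eigenvalue of the bottom block. -/
def omegaMinus (x y : ℝ) : ℝ := (-4 + x ^ 2 - √(disc x y)) / (2 * r1sq x y)

theorem r1sq_pos (x y : ℝ) : 0 < r1sq x y := by unfold r1sq; positivity

theorem r2sq_pos (x y : ℝ) : 0 < r2sq x y := by unfold r2sq; positivity

theorem omegaMinus_le_omegaPlus (x y : ℝ) : omegaMinus x y ≤ omegaPlus x y := by
  have h := r1sq_pos x y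
  unfold omegaMinus omegaPlus
  gcongr
  linarith [Real.sqrt_nonneg (disc x y)]

theorem trace_bottomBlock (x y : ℝ) :
    (bottomBlock x y).trace = omegaPlus x y + omegaMinus x y := by
  have h1 := (r1sq_pos x y).ne'
  have h2 := (r2sq_pos x y).ne'
  simp only [bottomBlock, omegaPlus, omegaMinus, Matrix.trace_smul, Matrix.trace_fin_two_of,
    smul_eq_mul]
  field_simp
  unfold r1sq r2sq
  ring

theorem det_bottomBlock (x y : ℝ) :
    (bottomBlock x y).det = omegaPlus x y * omegaMinus x y := by
  have h1 := (r1sq_pos x y).ne'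
  have h2 := (r2sq_pos x y).ne'
  have hs : √(r1sq x y) ^ 2 = r1sq x y := Real.sq_sqrt (r1sq_pos x y).le
  have h6 : (√(r1sq x y) ^ 3) ^ 2 = r1sq x y ^ 3 := by
    rw [← hs]; ring_nf; rw [Real.sqrt_sq (Real.sqrt_nonneg _)]
  have hd : √(disc x y) ^ 2 = disc x y := Real.sq_sqrt (by unfold disc; positivity)
  have hL : (bottomBlock x y).det = -4 * y ^ 2 * ((x ^ 2 - 4) ^ 2 * (x ^ 2 * y ^ 4 - 1)
      * r1sq x y + r1sq x y ^ 3) / (r1sq x y * r2sq x y) ^ 2 := by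
    simp only [bottomBlock, Matrix.det_smul, Matrix.det_fin_two_of, Fintype.card_fin]
    rw [← h6]
    field_simp
    ring
  have hR : omegaPlus x y * omegaMinus x y
      = ((-4 + x ^ 2) ^ 2 - disc x y) / (4 * r1sq x y ^ 2) := by
    rw [← hd]; unfold omegaPlus omegaMinus; field_simp; ring
  rw [hL, hR, div_eq_div_iff (by positivity) (by positivity)]
  unfold disc r1sq r2sq
  ring

/-- `omegaPlus` and `omegaMinus` are exactly the two eigenvalues of the bottom block. -/
theorem charpoly_bottomBlock (x y : ℝ) :
    (bottomBlock x y).charpoly =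
      (Polynomial.X - Polynomial.C (omegaPlus x y)) *
        (Polynomial.X - Polynomial.C (omegaMinus x y)) := by
  rw [Matrix.charpoly_fin_two, trace_bottomBlock, det_bottomBlock]
  simp only [map_add, map_mul]
  ring

/-- The region `R` of the half plane `x > 0` adjacent to `(2, 0)`, on which the eigenvalue of the
bottom block nearest to the last diagonal entry is `ω₊` for `x < 2` and `ω₋` for `x > 2`. -/
def R : Set (ℝ × ℝ) :=
  {p | 0 < p.1 ∧ 0 ≤ 4 - 4 * p.2 ^ 2 - p.1 ^ 2 * p.2 ^ 2 - 8 * p.1 ^ 2 * p.2 ^ 4}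

/-- On `R`, to the left of the line `x = 2`, the eigenvalue `ω₊` is the one nearest to the last
diagonal entry; to the right it is `ω₋`. -/
theorem bottomBlock_last_sub_mean (x y : ℝ) :
    bottomBlock x y 1 1 - (omegaPlus x y + omegaMinus x y) / 2 =
      (2 - x) * (2 + x) * (4 - 4 * y ^ 2 - x ^ 2 * y ^ 2 - 8 * x ^ 2 * y ^ 4) /
        (2 * r1sq x y * r2sq x y) := by
  have h1 := (r1sq_pos x y).ne'
  have h2 := (r2sq_pos x y).ne'
  simp only [bottomBlock, omegaPlus, omegaMinus, Matrix.smul_apply, smul_eq_mul,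
    Matrix.of_apply, Matrix.cons_val', Matrix.cons_val_one,
    Matrix.cons_val_fin_one]
  field_simp
  unfold r1sq r2sq
  ring

/-- `R₊ = R ∩ ((0, 2] × ℝ)`. -/
def Rplus : Set (ℝ × ℝ) := R ∩ {p | p.1 ≤ 2}

/-- The point `p₀ = (2, 0)`. -/
def p0 : ℝ × ℝ := (2, 0)

/-- The shifted QR step with shift `w`, in the coordinates `(x, y)`. -/
def shiftStep (w : ℝ) (p : ℝ × ℝ) : ℝ × ℝ :=
  ((1 + w) / (1 - w) * p.1, |w| / (1 + w) * p.2)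

/-- The branch `W₊`, used for `x ≤ 2`. -/
def WPlus (p : ℝ × ℝ) : ℝ × ℝ := shiftStep (omegaPlus p.1 p.2) p

/-- The branch `W₋`, used for `x ≥ 2`. -/
def WMinus (p : ℝ × ℝ) : ℝ × ℝ := shiftStep (omegaMinus p.1 p.2) p

/-- Wilkinson's step on `R`. It is genuinely defined off the line `x = 2`, and at `p₀`, which both
branches fix; its values elsewhere on that line are placeholders, never used by `OrbitDefined`. -/
def W (p : ℝ × ℝ) : ℝ × ℝ := if p.1 ≤ 2 then WPlus p else WMinus p

/-- The whole forward orbit of `z` under Wilkinson's step is defined: it stays in `R` and never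
meets the line `x = 2`, except possibly at the fixed point `p₀`. -/
def OrbitDefined (z : ℝ × ℝ) : Prop :=
  ∀ k : ℕ, W^[k] z ∈ R ∧ ((W^[k] z).1 = 2 → W^[k] z = p0)

/-- The set `𝒳` of the points whose orbit is defined and converges to `p₀`. -/
def X : Set (ℝ × ℝ) :=
  {z | OrbitDefined z ∧ Tendsto (fun k : ℕ => W^[k] z) atTop (𝓝 p0)}

open Classical in
/-- The sign sequence of `z`: its `k`-th term is `+1` iff the `k`-th iterate lies in `R₊`.
Signs are elements of `ℤˣ = {1, -1}`. -/
def signSeq (z : ℝ × ℝ) : ℕ → ℤˣ := fun k => if W^[k] z ∈ Rplus then 1 else -1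

/-- The wedge `V_a` of height `a` (used for `0 < a ≤ 1/10`). -/
def wedge (a : ℝ) : Set (ℝ × ℝ) := {p | |p.2| ≤ a ∧ |p.1 - 2| / 10 ≤ |p.2|}

/-- The NW face of `V_a` (without the apex `p₀`). -/
def faceNW (a : ℝ) : Set (ℝ × ℝ) := {p | 0 < p.2 ∧ p.2 ≤ a ∧ p.1 = 2 - 10 * p.2}

/-- The NE face of `V_a` (without the apex `p₀`). -/
def faceNE (a : ℝ) : Set (ℝ × ℝ) := {p | 0 < p.2 ∧ p.2 ≤ a ∧ p.1 = 2 + 10 * p.2}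

/-- The graph of `f` over `[l, r]`. -/
def arc (f : ℝ → ℝ) (l r : ℝ) : Set (ℝ × ℝ) := (fun x => (x, f x)) '' Icc l r

/-- The graph of `f` over `[l, r]` is an `L`-flat arc in the wedge `V_a`. -/
def IsFlatArc (L : ℝ≥0) (a : ℝ) (f : ℝ → ℝ) (l r : ℝ) : Prop :=
  l ≤ r ∧ LipschitzOnWith L f (Icc l r) ∧ arc f l r ⊆ wedge a

/-- The `L`-flat arc given by `f` over `[l, r]` is stretched by `G` across the wedge `V_a`:
its image contains an `L`-flat arc (given by `g` over `[l', r']`) in `V_a` from the NW face to the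
NE face, whose height is everywhere less than a quarter of every height on the original arc,
and `G` expands the horizontal coordinate, by a factor greater than `1`, on the part of the
original arc between the preimages of the endpoints of the new one. -/
def StretchedBy (G : ℝ × ℝ → ℝ × ℝ) (L : ℝ≥0) (a : ℝ) (f : ℝ → ℝ) (l r : ℝ) : Prop :=
  ∃ (g : ℝ → ℝ) (l' r' : ℝ), IsFlatArc L a g l' r' ∧
    (l', g l') ∈ faceNW a ∧ (r', g r') ∈ faceNE a ∧
    arc g l' r' ⊆ G '' arc f l r ∧
    (∀ p ∈ arc g l' r', ∀ q ∈ arc f l r, p.2 < 1 / 4 * q.2) ∧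
    ∃ u ∈ Icc l r, ∃ v ∈ Icc l r, G (u, f u) = (l', g l') ∧ G (v, f v) = (r', g r') ∧
      ∃ κ : ℝ, 1 < κ ∧ ∀ x ∈ Icc u v, ∀ x' ∈ Icc u v, x ≤ x' →
        κ * (x' - x) ≤ (G (x', f x')).1 - (G (x, f x)).1

/-- The stretching property of the constants `L`, `a`: every `L`-flat arc in `V_a` from the NW
face to the line `x = 2` is stretched across `V_a` by `W₊`, and every `L`-flat arc in `V_a` from
that line to the NE face is stretched across `V_a` by `W₋`. -/
def StretchesArcs (L : ℝ≥0) (a : ℝ) : Prop :=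
  (∀ (f : ℝ → ℝ) (l : ℝ), IsFlatArc L a f l 2 → (l, f l) ∈ faceNW a →
      StretchedBy WPlus L a f l 2) ∧
  (∀ (f : ℝ → ℝ) (r : ℝ), IsFlatArc L a f 2 r → (r, f r) ∈ faceNE a →
      StretchedBy WMinus L a f 2 r)

/-- `K` is a Cantor set in the arc `Γ`: a nonempty closed subset of `Γ` with empty interior in the
induced topology of `Γ` and without isolated points. -/
def IsCantorSetIn (K Γ : Set (ℝ × ℝ)) : Prop :=
  K ⊆ Γ ∧ K.Nonempty ∧ IsClosed ((↑) ⁻¹' K : Set Γ) ∧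
    interior ((↑) ⁻¹' K : Set Γ) = ∅ ∧ Preperfect K

/-- The graph `{(F y, y) : 0 ≤ y ≤ a}` of a function of the second coordinate. -/
def sideGraph (F : ℝ → ℝ) (a : ℝ) : Set (ℝ × ℝ) := (fun y => (F y, y)) '' Icc 0 a

end

end Wilkinson

namespace Wilkinson

noncomputable section

/-! The apex `p₀` behaves like a horseshoe with very strong vertical contraction. In a low wedge the
size of the shift is comparable to `y`, so a step shrinks heights by a large factor
(`branch_snd_bounds`). Along nearly horizontal directions the signed shift grows with `x`, which
gives horizontal expansion and an invariant cone of flat directions (`shift_sub_bounds`,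
`branch_cone`). The two ends of a flat arc crossing half the wedge are thrown out of the wedge on
opposite sides (`branch_exit_line`, `branch_exit_face`), so its image crosses the whole wedge again.

Outside the wedge an orbit shrinks its height too fast to reach the line `x = 2` (`outer_step`).
Hence, at small positive height, lying in `𝒳` amounts to staying in the wedge forever, and the sign
sequence records the half visited at each time (`follows_iff`). Every sequence is realized on every
crossing arc, by repeated stretching and compactness (`exists_follows`), and only once, by expansion
(`Follows.eq_of_flat`). Thus the sequence space embeds in the arc, with a Cantor set as image.
Uniqueness along all flat directions also says that two points with the same signs are separated
steeply, which is the Lipschitz bound for the curves. -/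

/-- The absolute value of the shift: `ω₊` for `e = 1`, and `-ω₋` for `e = -1`. -/
def rootAbs (e x y : ℝ) : ℝ := (e * (x ^ 2 - 4) + √(disc x y)) / (2 * r1sq x y)

/-- The branches of Wilkinson's step: `W₊` for `e = 1` and `W₋` for `e = -1`. -/
def branch (e : ℝ) (p : ℝ × ℝ) : ℝ × ℝ :=
  ((1 + e * rootAbs e p.1 p.2) / (1 - e * rootAbs e p.1 p.2) * p.1,
    rootAbs e p.1 p.2 / (1 + e * rootAbs e p.1 p.2) * p.2)

/-! ### The shift as a root of a quadratic equation -/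

theorem disc_eq (x y : ℝ) : disc x y = (x ^ 2 - 4) ^ 2 + 16 * x ^ 2 * y ^ 2 * r1sq x y := by
  unfold disc r1sq; ring

theorem abs_le_sqrt_disc (x y : ℝ) : |x ^ 2 - 4| ≤ √(disc x y) := by
  apply Real.abs_le_sqrt
  have := r1sq_pos x y
  have : 0 ≤ 16 * x ^ 2 * y ^ 2 * r1sq x y := by positivity
  rw [disc_eq]; linarith

theorem rootAbs_nonneg {e : ℝ} (he : e = 1 ∨ e = -1) (x y : ℝ) : 0 ≤ rootAbs e x y := by
  have h1 := r1sq_pos x y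
  have h2 := abs_le.1 (abs_le_sqrt_disc x y)
  unfold rootAbs
  apply div_nonneg _ (by positivity)
  rcases he with rfl | rfl <;> linarith [h2.1, h2.2]

theorem rootAbs_eq {e : ℝ} (he : e = 1 ∨ e = -1) (x y : ℝ) :
    r1sq x y * rootAbs e x y ^ 2 - e * (x ^ 2 - 4) * rootAbs e x y = 4 * x ^ 2 * y ^ 2 := by
  have h1 := (r1sq_pos x y).ne'
  have hd : √(disc x y) ^ 2 = disc x y := Real.sq_sqrt (by unfold disc; positivity)
  have he2 : e ^ 2 = 1 := by rcases he with rfl | rfl <;> norm_num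
  rw [disc_eq] at hd
  unfold rootAbs
  rw [disc_eq]
  generalize √((x ^ 2 - 4) ^ 2 + 16 * x ^ 2 * y ^ 2 * r1sq x y) = v at *
  field_simp
  linear_combination hd - (x ^ 2 - 4) ^ 2 * he2

theorem WPlus_eq : WPlus = branch 1 := by
  funext p
  have h : omegaPlus p.1 p.2 = rootAbs 1 p.1 p.2 := by
    unfold omegaPlus rootAbs; ring
  have h0 := rootAbs_nonneg (Or.inl rfl) p.1 p.2
  simp only [WPlus, shiftStep, branch, h, abs_of_nonneg h0, one_mul]

theorem WMinus_eq : WMinus = branch (-1) := by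
  funext p
  have h : omegaMinus p.1 p.2 = -rootAbs (-1) p.1 p.2 := by
    unfold omegaMinus rootAbs; ring
  have h0 := rootAbs_nonneg (Or.inr rfl) p.1 p.2
  simp only [WMinus, shiftStep, branch, h, abs_neg, abs_of_nonneg h0]
  ring_nf

/-! ### Cone, contraction and exit estimates in a half wedge -/

/-- The half of the wedge `V_a` in which the branch `e` is used. -/
def side (e a : ℝ) : Set (ℝ × ℝ) :=
  {p | 0 < p.2 ∧ p.2 ≤ a ∧ e * (p.1 - 2) ≤ 0 ∧ -(10 * p.2) ≤ e * (p.1 - 2)}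

theorem side_bounds {e x y : ℝ} (he : e = 1 ∨ e = -1) (h : (x, y) ∈ side e (1 / 100000)) :
    0 < y ∧ y ≤ 1 / 100000 ∧ 2 - 10 * y ≤ x ∧ x ≤ 2 + 10 * y := by
  obtain ⟨h1, h2, h3, h4⟩ := h
  simp only at h1 h2 h3 h4
  rcases he with rfl | rfl <;> refine ⟨h1, h2, ?_, ?_⟩ <;> linarith

theorem r1sq_bounds {x y : ℝ} (hy : 0 < y) (hy' : y ≤ 1 / 100000)
    (h1 : 2 - 10 * y ≤ x) (h2 : x ≤ 2 + 10 * y) :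
    799 / 100 ≤ r1sq x y ∧ r1sq x y ≤ 801 / 100 := by
  have hxl : (1.9999 : ℝ) ≤ x := by linarith
  have hxu : x ≤ 2.0001 := by linarith
  have e1 : (3.9995 : ℝ) ≤ x ^ 2 := by nlinarith
  have e2 : x ^ 2 ≤ 4.0005 := by nlinarith
  have e3 : y ^ 2 ≤ 0.0001 := by nlinarith
  have e4 : x ^ 2 * y ^ 2 ≤ 4.0005 * 0.0001 := by gcongr
  unfold r1sq
  constructor
  · nlinarith [sq_nonneg (x * y)]
  · nlinarith

theorem linear_coeff_bounds {e x y : ℝ} (he : e = 1 ∨ e = -1)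
    (h : (x, y) ∈ side e (1 / 100000)) :
    0 ≤ -(e * (x ^ 2 - 4)) ∧ -(e * (x ^ 2 - 4)) ≤ 40.01 * y := by
  obtain ⟨hy0, hy1, hx1, hx2⟩ := side_bounds he h
  have h3 : e * (x - 2) ≤ 0 := h.2.2.1
  have h4 : -(10 * y) ≤ e * (x - 2) := h.2.2.2
  have heq : -(e * (x ^ 2 - 4)) = -(e * (x - 2)) * (x + 2) := by ring
  rw [heq]
  refine ⟨mul_nonneg (by linarith) (by linarith), ?_⟩
  calc -(e * (x - 2)) * (x + 2) ≤ 10 * y * 4.001 := by gcongr <;> linarith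
    _ = _ := by ring

/-- Substituting `w = t * y` in `rootAbs_eq` gives approximately `8 t² + c t = 16` with `0 ≤ c ≤
40`, whose positive root lies between `3/10` and `3/2`. -/
theorem rootAbs_bounds {e x y : ℝ} (he : e = 1 ∨ e = -1) (h : (x, y) ∈ side e (1 / 100000)) :
    3 / 10 * y ≤ rootAbs e x y ∧ rootAbs e x y ≤ 3 / 2 * y := by
  obtain ⟨hy, hy', hx1, hx2⟩ := side_bounds he h
  obtain ⟨hr1, hr2⟩ := r1sq_bounds hy hy' hx1 hx2
  have hw := rootAbs_nonneg he x y
  have heq := rootAbs_eq he x y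
  set w := rootAbs e x y
  set r := r1sq x y
  have hxl : (1.9999 : ℝ) ≤ x := by linarith
  have hxu : x ≤ 2.0001 := by linarith
  have e1 : (3.9995 : ℝ) ≤ x ^ 2 := by nlinarith
  have e2 : x ^ 2 ≤ 4.0005 := by nlinarith
  have c1 : 15.99 * y ^ 2 ≤ 4 * x ^ 2 * y ^ 2 := by nlinarith [sq_nonneg y]
  have c2 : 4 * x ^ 2 * y ^ 2 ≤ 16.01 * y ^ 2 := by nlinarith [sq_nonneg y]
  obtain ⟨hq0, hq1⟩ := linear_coeff_bounds he h
  constructor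
  · by_contra! hlt
    have a1 : w ^ 2 ≤ (3 / 10 * y) ^ 2 := by gcongr
    have a2 : -(e * (x ^ 2 - 4)) * w ≤ 40.01 * y * (3 / 10 * y) := by gcongr
    have a3 : r * w ^ 2 ≤ 801 / 100 * (3 / 10 * y) ^ 2 := by gcongr
    nlinarith [sq_pos_of_pos hy]
  · by_contra! hlt
    have a1 : (3 / 2 * y) ^ 2 ≤ w ^ 2 := by gcongr
    have a2 : 0 ≤ -(e * (x ^ 2 - 4)) * w := by positivity
    have a3 : 799 / 100 * (3 / 2 * y) ^ 2 ≤ r * w ^ 2 := by gcongr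
    nlinarith [sq_pos_of_pos hy]

theorem abs_sub_products_le {x y x' y' : ℝ} (hy0 : 0 < y) (hy1 : y ≤ 1 / 100000)
    (hy1' : y' ≤ 1 / 100000) (hx1 : 2 - 10 * y ≤ x) (hx2 : x ≤ 2 + 10 * y)
    (hx1' : 2 - 10 * y' ≤ x') (hx2' : x' ≤ 2 + 10 * y')
    (hx : x ≤ x') (hy : |y' - y| ≤ 1 / 1000 * (x' - x)) :
    |4 * x' ^ 2 * y' ^ 2 - 4 * x ^ 2 * y ^ 2| ≤ 35 / 1000 * y * (x' - x) := by
  obtain ⟨hya, hyb⟩ := abs_le.1 hy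
  have hd0 : 0 ≤ x' - x := by linarith
  have : 4 * x' ^ 2 * y' ^ 2 - 4 * x ^ 2 * y ^ 2 =
      4 * (x' * y' + x * y) * (x' * (y' - y) + y * (x' - x)) := by ring
  rw [this, abs_mul, abs_mul]
  have b1 : |x' * y' + x * y| ≤ 407 / 100 * y := by
    -- Since `x' - x ≤ 10 * (y + y')`, flatness forces `y' ≤ 1.03 * y`.
    have u1 : x' * y' ≤ 2.0001 * (1.03 * y) := by gcongr <;> linarith
    have u2 : x * y ≤ 2.0001 * y := by gcongr; linarith
    have u3 : 0 ≤ x' * y' := mul_nonneg (by linarith) (by linarith)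
    have u4 : 0 ≤ x * y := mul_nonneg (by linarith) (by linarith)
    rw [abs_of_nonneg (by linarith)]
    linarith
  have b2 : |x' * (y' - y) + y * (x' - x)| ≤ 211 / 100000 * (x' - x) := by
    calc |x' * (y' - y) + y * (x' - x)| ≤ |x' * (y' - y)| + |y * (x' - x)| := abs_add_le _ _
      _ = x' * |y' - y| + y * (x' - x) := by
          rw [abs_mul, abs_of_nonneg (by linarith : 0 ≤ x'), abs_of_nonneg (mul_nonneg hy0.le hd0)]
      _ ≤ 2.0001 * (1 / 1000 * (x' - x)) + 1 / 100000 * (x' - x) := by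
          gcongr; linarith
      _ ≤ 211 / 100000 * (x' - x) := by linarith
  calc |(4 : ℝ)| * |x' * y' + x * y| * |x' * (y' - y) + y * (x' - x)|
      ≤ 4 * (407 / 100 * y) * (211 / 100000 * (x' - x)) := by
        rw [abs_of_pos (by norm_num : (0 : ℝ) < 4)]; gcongr
    _ ≤ 35 / 1000 * y * (x' - x) := by linarith [mul_nonneg hy0.le hd0]

/-- The shift `e * rootAbs e` grows with `x` along flat directions. -/
theorem shift_sub_bounds {e x y x' y' : ℝ} (he : e = 1 ∨ e = -1)
    (h : (x, y) ∈ side e (1 / 100000)) (h' : (x', y') ∈ side e (1 / 100000))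
    (hx : x ≤ x') (hy : |y' - y| ≤ 1 / 1000 * (x' - x)) :
    3 / 200 * (x' - x) ≤ e * rootAbs e x' y' - e * rootAbs e x y ∧
      e * rootAbs e x' y' - e * rootAbs e x y ≤ 3 / 5 * (x' - x) := by
  obtain ⟨hy0, hy1, hx1, hx2⟩ := side_bounds he h
  obtain ⟨hy0', hy1', hx1', hx2'⟩ := side_bounds he h'
  obtain ⟨hr1, hr2⟩ := r1sq_bounds hy0 hy1 hx1 hx2
  obtain ⟨hr1', hr2'⟩ := r1sq_bounds hy0' hy1' hx1' hx2'
  obtain ⟨hw1, hw2⟩ := rootAbs_bounds he h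
  obtain ⟨hw1', hw2'⟩ := rootAbs_bounds he h'
  have heq := rootAbs_eq he x y
  have heq' := rootAbs_eq he x' y'
  have hrd : r1sq x' y' - r1sq x y =
      (x' - x) * (x' + x) + (4 * x' ^ 2 * y' ^ 2 - 4 * x ^ 2 * y ^ 2) := by unfold r1sq; ring
  generalize rootAbs e x y = w at *
  generalize rootAbs e x' y' = w' at *
  generalize r1sq x y = r at *
  generalize r1sq x' y' = r' at *
  set d := x' - x with hd
  have hd0 : 0 ≤ d := by linarith
  obtain ⟨hya, hyb⟩ := abs_le.1 hy
  have he2 : e ^ 2 = 1 := by rcases he with rfl | rfl <;> norm_num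
  have hyy : y' ≤ 1.03 * y := by linarith
  have hmb := abs_sub_products_le hy0 hy1 hy1' hx1 hx2 hx1' hx2' hx hy
  set m := 4 * x' ^ 2 * y' ^ 2 - 4 * x ^ 2 * y ^ 2 with hm
  have hyd : 0 ≤ y * d := mul_nonneg hy0.le hd0
  have hyd' : y * d ≤ 1 / 100000 * d := by gcongr
  -- the rest term
  set t := e * m - e * (r' - r) * w ^ 2 with ht
  have hw0 : 0 ≤ w := by linarith
  have hw2s : w ^ 2 ≤ (3 / 100000) * y := by
    have : w ^ 2 ≤ (3 / 2 * y) ^ 2 := by gcongr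
    have : y * y ≤ 1 / 100000 * y := by gcongr
    linarith
  have htb : |t| ≤ 36 / 1000 * y * d := by
    have habs : |e| = 1 := by rcases he with rfl | rfl <;> norm_num
    have b3 : |r' - r| ≤ 4.1 * d := by
      rw [hrd]
      calc |d * (x' + x) + m| ≤ |d * (x' + x)| + |m| := abs_add_le _ _
        _ ≤ d * 4.01 + 35 / 1000 * y * d := by
            rw [abs_of_nonneg (mul_nonneg hd0 (by linarith))]; gcongr; linarith
        _ ≤ 4.1 * d := by linarith
    calc |t| ≤ |e * m| + |e * (r' - r) * w ^ 2| := abs_sub _ _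
      _ = |m| + |r' - r| * w ^ 2 := by
          rw [abs_mul, abs_mul, abs_mul, habs, abs_of_nonneg (sq_nonneg w)]; ring
      _ ≤ 35 / 1000 * y * d + 4.1 * d * ((3 / 100000) * y) := by gcongr
      _ ≤ 36 / 1000 * y * d := by linarith
  obtain ⟨ht1, ht2⟩ := abs_le.1 htb
  set B := r' * (w + w') - e * (x' ^ 2 - 4) with hB
  have key : (e * w' - e * w) * B = d * (x' + x) * w + t := by
    rw [ht, hm, hB, hd]
    linear_combination e * heq' - e * heq - (x ^ 2 - x' ^ 2) * w * he2
  obtain ⟨hq0, hq1⟩ := linear_coeff_bounds he h'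
  have hww : 0 ≤ w + w' := by linarith
  have hBu : B ≤ 70 * y := by
    have : r' * (w + w') ≤ 801 / 100 * (w + w') := by gcongr
    linarith
  have hBl : 7.9 * w ≤ B := by
    have : 799 / 100 * (w + w') ≤ r' * (w + w') := by gcongr
    linarith
  have hwp : 0 < w := by linarith
  have hBp : 0 < B := by linarith
  have hdw : 0 ≤ d * w := by positivity
  have hyw : d * (3 / 10 * y) ≤ d * w := by gcongr
  have hM1 : 3.99 * (d * w) ≤ d * (x' + x) * w := by
    linarith [mul_le_mul_of_nonneg_left (by linarith : 3.99 ≤ x' + x) hdw]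
  have hM2 : d * (x' + x) * w ≤ 4.01 * (d * w) := by
    linarith [mul_le_mul_of_nonneg_left (by linarith : x' + x ≤ 4.01) hdw]
  constructor
  · by_contra! hlt
    have : (e * w' - e * w) * B < 3 / 200 * d * B := by gcongr
    have : 3 / 200 * d * B ≤ 3 / 200 * d * (70 * y) := by gcongr
    linarith
  · by_contra! hlt
    have : 3 / 5 * d * B < (e * w' - e * w) * B := by gcongr
    have : 3 / 5 * d * (7.9 * w) ≤ 3 / 5 * d * B := by gcongr
    linarith

theorem shift_abs_le {e x y : ℝ} (he : e = 1 ∨ e = -1) (h : (x, y) ∈ side e (1 / 100000)) :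
    -(1 / 50000) ≤ e * rootAbs e x y ∧ e * rootAbs e x y ≤ 1 / 50000 := by
  obtain ⟨h1, h2, -⟩ := side_bounds he h
  obtain ⟨hw1, hw2⟩ := rootAbs_bounds he h
  rcases he with rfl | rfl <;> constructor <;> linarith

/-- On half a wedge a branch expands flat directions horizontally, and its image is flat. -/
theorem branch_cone {e : ℝ} {p q : ℝ × ℝ} (he : e = 1 ∨ e = -1)
    (hp : p ∈ side e (1 / 100000)) (hq : q ∈ side e (1 / 100000))
    (hx : p.1 ≤ q.1) (hy : |q.2 - p.2| ≤ 1 / 1000 * (q.1 - p.1)) :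
    21 / 20 * (q.1 - p.1) ≤ (branch e q).1 - (branch e p).1 ∧
      |(branch e q).2 - (branch e p).2| ≤ 1 / 1000 * ((branch e q).1 - (branch e p).1) := by
  obtain ⟨x, y⟩ := p
  obtain ⟨x', y'⟩ := q
  simp only at hx hy
  obtain ⟨hy0, hy1, hx1, hx2⟩ := side_bounds he hp
  obtain ⟨hy0', hy1', hx1', hx2'⟩ := side_bounds he hq
  obtain ⟨hd1, hd2⟩ := shift_sub_bounds he hp hq hx hy
  obtain ⟨ha, hb⟩ := shift_abs_le he hp
  obtain ⟨ha', hb'⟩ := shift_abs_le he hq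
  have he2 : e ^ 2 = 1 := by rcases he with rfl | rfl <;> norm_num
  have habs : |e| = 1 := by rcases he with rfl | rfl <;> norm_num
  simp only [branch]
  have hw : rootAbs e x y = e * (e * rootAbs e x y) := by linear_combination -rootAbs e x y * he2
  have hw' : rootAbs e x' y' = e * (e * rootAbs e x' y') := by
    linear_combination -rootAbs e x' y' * he2
  generalize hu : e * rootAbs e x y = u at *
  generalize hu' : e * rootAbs e x' y' = u' at *
  rw [hw, hw']
  set d := x' - x with hd
  have hd0 : 0 ≤ d := by linarith
  have p1 : 0 < 1 - u := by linarith
  have p2 : 0 < 1 - u' := by linarith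
  have p3 : 0 < 1 + u := by linarith
  have p4 : 0 < 1 + u' := by linarith
  -- The first factor may fall slightly below 1. The expansion comes from the second term, the
  -- growth of the shift, multiplied by `2 * x ≈ 4`.
  have ex : (1 + u') / (1 - u') * x' - (1 + u) / (1 - u) * x =
      (1 + u') / (1 - u') * d + 2 * x * (u' - u) / ((1 - u) * (1 - u')) := by
    rw [hd]; field_simp; ring
  have first : 21 / 20 * d ≤ (1 + u') / (1 - u') * x' - (1 + u) / (1 - u) * x := by
    rw [ex]
    have f1 : 0.999 ≤ (1 + u') / (1 - u') := by rw [le_div_iff₀ p2]; linarith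
    have f2 : 0.055 * d ≤ 2 * x * (u' - u) / ((1 - u) * (1 - u')) := by
      rw [le_div_iff₀ (by positivity)]
      have g1 : (1 - u) * (1 - u') ≤ 1.001 := by nlinarith
      have hx39 : 3.9 ≤ 2 * x := by linarith
      have g2 : 3.9 * (3 / 200 * d) ≤ 2 * x * (u' - u) := by gcongr
      calc 0.055 * d * ((1 - u) * (1 - u')) ≤ 0.055 * d * 1.001 := by gcongr
        _ ≤ _ := by linarith
    have f3 : 0.999 * d ≤ (1 + u') / (1 - u') * d := by gcongr
    linarith
  refine ⟨first, ?_⟩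
  have ey : e * u' / (1 + u') * y' - e * u / (1 + u) * y =
      e * (u' / (1 + u') * (y' - y) + y * (u' - u) / ((1 + u) * (1 + u'))) := by
    field_simp; ring
  rw [ey, abs_mul, habs, one_mul]
  have k1 : |u' / (1 + u')| ≤ 0.001 := by
    rw [abs_le]; constructor
    · rw [le_div_iff₀ p4]; linarith
    · rw [div_le_iff₀ p4]; linarith
  have k2 : |y * (u' - u) / ((1 + u) * (1 + u'))| ≤ 0.0001 * d := by
    have hnn : 0 ≤ u' - u := by linarith
    rw [abs_of_nonneg (by positivity), div_le_iff₀ (by positivity)]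
    have g1 : 0.9 ≤ (1 + u) * (1 + u') := by nlinarith
    calc y * (u' - u) ≤ 1 / 100000 * (3 / 5 * d) := by gcongr
      _ ≤ 0.0001 * d * 0.9 := by linarith
      _ ≤ _ := by gcongr
  calc _ ≤ |u' / (1 + u') * (y' - y)| + |y * (u' - u) / ((1 + u) * (1 + u'))| := abs_add_le _ _
    _ ≤ 0.001 * (1 / 1000 * d) + 0.0001 * d := by rw [abs_mul]; gcongr
    _ ≤ 1 / 1000 * (21 / 20 * d) := by linarith
    _ ≤ _ := by gcongr

theorem branch_snd_bounds {e : ℝ} {p : ℝ × ℝ} (he : e = 1 ∨ e = -1)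
    (hp : p ∈ side e (1 / 100000)) :
    0 < (branch e p).2 ∧ (branch e p).2 ≤ 1 / 100 * p.2 := by
  obtain ⟨x, y⟩ := p
  obtain ⟨hy0, hy1, -⟩ := side_bounds he hp
  obtain ⟨ha, hb⟩ := shift_abs_le he hp
  obtain ⟨hw1, hw2⟩ := rootAbs_bounds he hp
  simp only [branch]
  have hw0 : 0 < rootAbs e x y := by linarith
  have p3 : 0 < 1 + e * rootAbs e x y := by linarith
  refine ⟨by positivity, ?_⟩
  refine mul_le_mul_of_nonneg_right ?_ hy0.le
  rw [div_le_iff₀ p3]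
  linarith

/-- The horizontal displacement is about `4 * w ≥ 1.2 * y`, while the new height is at most `y /
100`: the image lies beyond the opposite face. -/
theorem branch_exit_line {e y : ℝ} (he : e = 1 ∨ e = -1) (hp : (2, y) ∈ side e (1 / 100000)) :
    10 * (branch e (2, y)).2 < e * ((branch e (2, y)).1 - 2) := by
  have h2 := (branch_snd_bounds he hp).2
  obtain ⟨hy0, hy1, -⟩ := side_bounds he hp
  obtain ⟨ha, hb⟩ := shift_abs_le he hp
  obtain ⟨hw1, hw2⟩ := rootAbs_bounds he hp
  have he2 : e ^ 2 = 1 := by rcases he with rfl | rfl <;> norm_num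
  simp only at h2
  have hx : e * ((branch e (2, y)).1 - 2) = 4 * rootAbs e 2 y / (1 - e * rootAbs e 2 y) := by
    simp only [branch]
    have : 1 - e * rootAbs e 2 y ≠ 0 := by linarith
    field_simp
    linear_combination 4 * rootAbs e 2 y * he2
  rw [hx, lt_div_iff₀ (by linarith)]
  have hs : 0 < (branch e (2, y)).2 := (branch_snd_bounds he hp).1
  nlinarith

/-- The step moves at most `7 * y` of the distance `10 * y` to the line, while the height drops to
at most `y / 100`, so the image stays outside the wedge on the same side. -/
theorem branch_exit_face {e x y : ℝ} (he : e = 1 ∨ e = -1) (hp : (x, y) ∈ side e (1 / 100000))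
    (hf : e * (x - 2) = -(10 * y)) :
    e * ((branch e (x, y)).1 - 2) < -(10 * (branch e (x, y)).2) := by
  have h2 := (branch_snd_bounds he hp).2
  obtain ⟨hy0, hy1, hx1, hx2⟩ := side_bounds he hp
  obtain ⟨ha, hb⟩ := shift_abs_le he hp
  obtain ⟨hw1, hw2⟩ := rootAbs_bounds he hp
  have he2 : e ^ 2 = 1 := by rcases he with rfl | rfl <;> norm_num
  simp only at h2
  have hx : e * ((branch e (x, y)).1 - 2) =
      e * (x - 2) + 2 * x * rootAbs e x y / (1 - e * rootAbs e x y) := by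
    simp only [branch]
    have : 1 - e * rootAbs e x y ≠ 0 := by linarith
    field_simp
    linear_combination 2 * x * rootAbs e x y * he2
  have : 2 * x * rootAbs e x y / (1 - e * rootAbs e x y) ≤ 7 * y := by
    rw [div_le_iff₀ (by linarith)]
    have : 2 * x * rootAbs e x y ≤ 2 * 2.01 * (3 / 2 * y) := by gcongr <;> linarith
    nlinarith
  rw [hx, hf]
  linarith

theorem continuousOn_branch {e : ℝ} (he : e = 1 ∨ e = -1) :
    ContinuousOn (branch e) (side e (1 / 100000)) := by
  have hw : Continuous fun p : ℝ × ℝ => rootAbs e p.1 p.2 := by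
    unfold rootAbs disc
    refine Continuous.div (by fun_prop) (by unfold r1sq; fun_prop) fun p => ?_
    have := r1sq_pos p.1 p.2
    positivity
  unfold branch
  refine ContinuousOn.prodMk ?_ ?_
  · refine ContinuousOn.mul (ContinuousOn.div (by fun_prop) (by fun_prop) ?_) (by fun_prop)
    intro p hp
    have := shift_abs_le he (x := p.1) (y := p.2) hp
    linarith [this.2]
  · refine ContinuousOn.mul (ContinuousOn.div (by fun_prop) (by fun_prop) ?_) (by fun_prop)
    intro p hp
    have := shift_abs_le he (x := p.1) (y := p.2) hp
    linarith [this.1]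

/-! ### Escape of orbits outside the wedge -/

theorem W_eq_branch {e : ℝ} (he : e = 1 ∨ e = -1) {p : ℝ × ℝ} (h : e * (p.1 - 2) < 0) :
    W p = branch e p := by
  rcases he with rfl | rfl
  · rw [W, if_pos (by linarith), WPlus_eq]
  · rw [W, if_neg (by linarith), WMinus_eq]

/-- Dropping the square term of `rootAbs_eq` leaves `H * (x + 2) * w ≤ 4 * x² * y²`. For `x ≤ 4`
this gives `H * w ≤ 32/3 * y²`, and `H ≥ 10 * y`. -/
theorem outer_rootAbs_le {e x y : ℝ} (he : e = 1 ∨ e = -1) (hx : 0 < x) (hx4 : x ≤ 4)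
    (hy : 0 ≤ y) (hh : 0 < -(e * (x - 2))) (hxy : 10 * y ≤ -(e * (x - 2))) :
    rootAbs e x y ≤ 107 / 100 * y := by
  have heq := rootAbs_eq he x y
  have hw := rootAbs_nonneg he x y
  have hr := r1sq_pos x y
  set w := rootAbs e x y
  set H := -(e * (x - 2)) with hH
  have h1 : H * (x + 2) * w ≤ 4 * x ^ 2 * y ^ 2 := by
    have : 0 ≤ r1sq x y * w ^ 2 := by positivity
    rw [hH]; linarith
  have h2 : x ^ 2 ≤ 8 / 3 * (x + 2) := by nlinarith
  have h3 : 4 * x ^ 2 * y ^ 2 ≤ 4 * (8 / 3 * (x + 2)) * y ^ 2 := by gcongr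
  have h4 : H * w ≤ 32 / 3 * y ^ 2 := by
    have : (H * w) * (x + 2) ≤ 32 / 3 * y ^ 2 * (x + 2) := by linarith
    exact le_of_mul_le_mul_right this (by linarith)
  have h5 : 32 / 3 * y ^ 2 ≤ H * (107 / 100 * y) := by nlinarith
  exact le_of_mul_le_mul_left (h4.trans h5) hh

/-- Outside the wedge the distance to the line `x = 2` stays bounded below along orbits. -/
theorem outer_step {e d : ℝ} (he : e = 1 ∨ e = -1) (hd : 0 < d) (hd1 : d ≤ 1) {p : ℝ × ℝ}
    (hx : 0 < p.1) (hy : 0 ≤ p.2) (hy1 : p.2 ≤ 1 / 100000)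
    (hw : 10 * p.2 ≤ -(e * (p.1 - 2))) (hdp : d + 19 / 2 * p.2 ≤ -(e * (p.1 - 2))) :
    0 ≤ (branch e p).2 ∧ (branch e p).2 ≤ 1 / 100000 ∧
      10 * (branch e p).2 ≤ -(e * ((branch e p).1 - 2)) ∧
      d + 19 / 2 * (branch e p).2 ≤ -(e * ((branch e p).1 - 2)) := by
  obtain ⟨x, y⟩ := p
  simp only at hx hy hy1 hw hdp
  have hw0 := rootAbs_nonneg he x y
  -- A small shift divides the height by at least 100. For `x ≤ 4` the loss of distance is at most
  -- `8.8 * y`, so the margins `19/2 * y` and `10 * y` pay for it and for the next height.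
  suffices h : rootAbs e x y ≤ 1 / 1000 ∧
      max (d + 19 / 2 * (y / 100)) (10 * (y / 100)) ≤ -(e * ((branch e (x, y)).1 - 2)) by
    obtain ⟨h1, h2⟩ := h
    have hle : (branch e (x, y)).2 ≤ y / 100 := by
      simp only [branch]
      have p3 : 999 / 1000 ≤ 1 + e * rootAbs e x y := by rcases he with rfl | rfl <;> linarith
      have : rootAbs e x y / (1 + e * rootAbs e x y) ≤ 1 / 100 := by
        rw [div_le_iff₀ (by linarith)]; linarith
      calc _ ≤ 1 / 100 * y := mul_le_mul_of_nonneg_right this hy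
        _ = y / 100 := by ring
    have hge : 0 ≤ (branch e (x, y)).2 := by
      simp only [branch]
      have p3 : 0 ≤ 1 + e * rootAbs e x y := by rcases he with rfl | rfl <;> linarith
      positivity
    have h3 := (le_max_left _ _).trans h2
    have h4 := (le_max_right _ _).trans h2
    refine ⟨hge, ?_, ?_, ?_⟩ <;> linarith
  rcases le_or_gt x 4 with h4 | h4
  · have hle := outer_rootAbs_le he hx h4 hy (by linarith) hw
    refine ⟨by linarith, ?_⟩
    have he2 : e ^ 2 = 1 := by rcases he with rfl | rfl <;> norm_num
    have p1 : 999 / 1000 ≤ 1 - e * rootAbs e x y := by rcases he with rfl | rfl <;> linarith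
    have hx' : -(e * ((branch e (x, y)).1 - 2)) =
        -(e * (x - 2)) - 2 * x * rootAbs e x y / (1 - e * rootAbs e x y) := by
      simp only [branch]
      have : 1 - e * rootAbs e x y ≠ 0 := by linarith
      field_simp
      linear_combination -2 * x * rootAbs e x y * he2
    have : 2 * x * rootAbs e x y / (1 - e * rootAbs e x y) ≤ 88 / 10 * y := by
      rw [div_le_iff₀ (by linarith)]
      calc 2 * x * rootAbs e x y ≤ 2 * 4 * (107 / 100 * y) := by gcongr
        _ ≤ 88 / 10 * y * (999 / 1000) := by linarith
        _ ≤ _ := by gcongr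
    rw [hx']
    apply max_le <;> linarith
  -- Far to the right the shift is `O(y²)`, so the new abscissa exceeds `3.96`, at distance well
  -- above `d ≤ 1` from the line.
  · have he' : e = -1 := he.resolve_left fun h => by rw [h] at hdp; linarith
    subst he'
    have heq := rootAbs_eq he x y
    have hr := r1sq_pos x y
    simp only [branch]
    generalize rootAbs (-1) x y = w at *
    have h1 : (x ^ 2 - 4) * w ≤ 4 * x ^ 2 * y ^ 2 := by
      have : 0 ≤ r1sq x y * w ^ 2 := by positivity
      linarith
    have h12 : 12 ≤ x ^ 2 - 4 := by nlinarith
    have h2 : 4 * x ^ 2 * y ^ 2 ≤ (x ^ 2 - 4) * (16 / 3 * y ^ 2) := by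
      nlinarith [mul_nonneg (by linarith : (0 : ℝ) ≤ x ^ 2 - 16) (sq_nonneg y)]
    have h3 : w ≤ 16 / 3 * y ^ 2 := le_of_mul_le_mul_left (h1.trans h2) (by linarith)
    have h5 : w ≤ 1 / 1000 := by nlinarith
    refine ⟨h5, ?_⟩
    have h6 : 99 / 100 ≤ (1 + -1 * w) / (1 - -1 * w) := by
      rw [le_div_iff₀ (by linarith)]; linarith
    have h7 : 99 / 100 * 4 ≤ (1 + -1 * w) / (1 - -1 * w) * x := by gcongr
    apply max_le <;> linarith

theorem abs_lt_of_mem_X {z : ℝ × ℝ} (hz : z ∈ X) (hy : 0 ≤ z.2) (hy1 : z.2 ≤ 1 / 100000)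
    (h0 : z ≠ p0) : |z.1 - 2| < 10 * z.2 := by
  by_contra! hlt
  obtain ⟨e, he, habs⟩ : ∃ e : ℝ, (e = 1 ∨ e = -1) ∧ |z.1 - 2| = -(e * (z.1 - 2)) := by
    rcases le_total z.1 2 with h | h
    · exact ⟨1, Or.inl rfl, by rw [abs_of_nonpos (by linarith)]; ring⟩
    · exact ⟨-1, Or.inr rfl, by rw [abs_of_nonneg (by linarith)]; ring⟩
  have hpos : 0 < |z.1 - 2| := by
    rw [abs_pos]
    intro h
    apply h0
    rw [h, abs_zero] at hlt
    exact Prod.ext (by simp only [p0]; linarith) (by simp only [p0]; linarith)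
  set d := min 1 (|z.1 - 2| - 19 / 2 * z.2) with hd
  have hd0 : 0 < d := lt_min one_pos (by linarith)
  have hd1 : d ≤ 1 := min_le_left _ _
  have hinv : ∀ k, 0 ≤ (W^[k] z).2 ∧ (W^[k] z).2 ≤ 1 / 100000 ∧
      10 * (W^[k] z).2 ≤ -(e * ((W^[k] z).1 - 2)) ∧
      d + 19 / 2 * (W^[k] z).2 ≤ -(e * ((W^[k] z).1 - 2)) := by
    intro k
    induction k with
    | zero =>
      have : d ≤ |z.1 - 2| - 19 / 2 * z.2 := min_le_right _ _
      simp only [Function.iterate_zero, id]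
      rw [← habs]
      exact ⟨hy, hy1, hlt, by linarith⟩
    | succ k ih =>
      obtain ⟨i1, i2, i3, i4⟩ := ih
      rw [Function.iterate_succ_apply', W_eq_branch he (by linarith)]
      exact outer_step he hd0 hd1 (hz.1 k).1.1 i1 i2 i3 i4
  have hlim : Tendsto (fun k => -(e * ((W^[k] z).1 - 2))) atTop (𝓝 (-(e * (p0.1 - 2)))) :=
    (((continuous_fst.tendsto _).comp hz.2).sub_const 2 |>.const_mul e).neg
  have := ge_of_tendsto' hlim fun k => (by have := hinv k; linarith : d ≤ _)
  simp [p0] at this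
  linarith

/-! ### Itineraries and their relation to `X` -/

/-- The real number `±1` given by a sign. -/
def sgn (u : ℤˣ) : ℝ := ((u : ℤ) : ℝ)

theorem sgn_eq (u : ℤˣ) : sgn u = 1 ∨ sgn u = -1 := by
  rcases Int.units_eq_one_or u with rfl | rfl <;> simp [sgn]

/-- The orbit of `z` under the branches prescribed by `s`. -/
def itin (s : ℕ → ℤˣ) (z : ℝ × ℝ) : ℕ → ℝ × ℝ
  | 0 => z
  | n + 1 => branch (sgn (s n)) (itin s z n)

theorem itin_succ_eq (s : ℕ → ℤˣ) (z : ℝ × ℝ) (n : ℕ) :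
    itin s z (n + 1) = itin (fun k => s (k + 1)) (branch (sgn (s 0)) z) n := by
  induction n with
  | zero => rfl
  | succ n ih => rw [itin, ih]; rfl

theorem itin_congr {s t : ℕ → ℤˣ} {n : ℕ} (h : ∀ j < n, s j = t j) (z : ℝ × ℝ) :
    itin s z n = itin t z n := by
  induction n with
  | zero => rfl
  | succ n ih => rw [itin, itin, ih fun j hj => h j (by omega), h n (by omega)]

/-- The orbit of `z` stays in the wedge of height `a`, on the sides prescribed by `s`. -/
def Follows (a : ℝ) (s : ℕ → ℤˣ) (z : ℝ × ℝ) : Prop :=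
  ∀ k, itin s z k ∈ side (sgn (s k)) a

theorem side_mono {e a b : ℝ} (h : a ≤ b) : side e a ⊆ side e b :=
  fun _ hp => ⟨hp.1, hp.2.1.trans h, hp.2.2⟩

theorem side_subset_R {e : ℝ} (he : e = 1 ∨ e = -1) : side e (1 / 100000) ⊆ R := by
  intro p hp
  obtain ⟨h1, h2, h3, h4⟩ := side_bounds (x := p.1) (y := p.2) he hp
  refine ⟨by linarith, ?_⟩
  have h5 : p.1 ^ 2 ≤ 3 ^ 2 := by gcongr <;> linarith
  have h6 : p.2 ^ 2 ≤ (1 / 100000) ^ 2 := by gcongr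
  have h7 : p.2 ^ 4 ≤ (1 / 100000) ^ 4 := by gcongr
  have h8 : p.1 ^ 2 * p.2 ^ 2 ≤ 3 ^ 2 * (1 / 100000) ^ 2 := by gcongr
  have h9 : p.1 ^ 2 * p.2 ^ 4 ≤ 3 ^ 2 * (1 / 100000) ^ 4 := by gcongr
  norm_num at *
  linarith

variable {a : ℝ} {s : ℕ → ℤˣ} {z : ℝ × ℝ}

/-- Half wedges include the line `x = 2`, but by `branch_exit_line` a point on it leaves the wedge
at the next step. -/
theorem Follows.fst_ne (h : Follows a s z) (ha : a ≤ 1 / 100000) (k : ℕ) :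
    (itin s z k).1 ≠ 2 := by
  intro hk
  have h1 := side_mono ha (h k)
  have h2 := h (k + 1)
  have hz : itin s z k = (2, (itin s z k).2) := Prod.ext hk rfl
  rw [hz] at h1
  have h3 := branch_exit_line (sgn_eq (s k)) h1
  rw [← hz, ← itin] at h3
  obtain ⟨h4, -, h5, h6⟩ := h2
  rcases sgn_eq (s k) with e1 | e1 <;> rcases sgn_eq (s (k + 1)) with e2 | e2 <;>
    rw [e1] at h3 <;> rw [e2] at h5 h6 <;> linarith

theorem Follows.lt (h : Follows a s z) (ha : a ≤ 1 / 100000) (k : ℕ) :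
    sgn (s k) * ((itin s z k).1 - 2) < 0 := by
  refine lt_of_le_of_ne (h k).2.2.1 (mul_ne_zero ?_ (sub_ne_zero.2 (h.fst_ne ha k)))
  rcases sgn_eq (s k) with e1 | e1 <;> rw [e1] <;> norm_num

theorem Follows.iterate_eq (h : Follows a s z) (ha : a ≤ 1 / 100000) (k : ℕ) :
    W^[k] z = itin s z k := by
  induction k with
  | zero => rfl
  | succ k ih =>
    rw [Function.iterate_succ_apply', ih, W_eq_branch (sgn_eq _) (h.lt ha k), itin]

theorem Follows.signSeq_eq (h : Follows a s z) (ha : a ≤ 1 / 100000) : signSeq z = s := by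
  funext k
  have h1 := h.lt ha k
  have hR := side_subset_R (sgn_eq _) (side_mono ha (h k))
  rw [← h.iterate_eq ha k] at h1 hR
  unfold signSeq
  rcases Int.units_eq_one_or (s k) with e1 | e1 <;> rw [e1] at h1 ⊢ <;> simp only [sgn] at h1 <;>
    push_cast at h1
  · exact if_pos ⟨hR, show (W^[k] z).1 ≤ 2 by linarith⟩
  · exact if_neg fun hc => by have : (W^[k] z).1 ≤ 2 := hc.2; linarith

theorem Follows.mem_X (h : Follows a s z) (ha : a ≤ 1 / 100000) : z ∈ X := by
  refine ⟨fun k => ?_, ?_⟩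
  · rw [h.iterate_eq ha k]
    exact ⟨side_subset_R (sgn_eq _) (side_mono ha (h k)), fun h2 => absurd h2 (h.fst_ne ha k)⟩
  · have hy : ∀ k, (W^[k] z).2 ≤ (1 / 100) ^ k * z.2 := by
      intro k
      rw [h.iterate_eq ha k]
      induction k with
      | zero => simp [itin]
      | succ k ih =>
        have := (branch_snd_bounds (sgn_eq _) (side_mono ha (h k))).2
        rw [itin, pow_succ]
        linarith
    have hlim : Tendsto (fun k : ℕ => (1 / 100 : ℝ) ^ k * z.2) atTop (𝓝 0) := by
      simpa using (tendsto_pow_atTop_nhds_zero_of_lt_one (r := (1 / 100 : ℝ))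
        (by norm_num) (by norm_num)).mul_const z.2
    refine Tendsto.prodMk_nhds ?_ ?_
    · rw [tendsto_iff_norm_sub_tendsto_zero]
      refine squeeze_zero (fun _ => norm_nonneg _) (fun k => ?_)
        (by simpa only [mul_zero] using hlim.const_mul 10)
      have h1 := side_bounds (sgn_eq _) (side_mono ha (h k))
      have h2 := hy k
      rw [← h.iterate_eq ha k] at h1
      rw [Real.norm_eq_abs, abs_le]
      constructor <;> linarith [h1.2.2]
    · refine squeeze_zero (fun k => ?_) hy hlim
      have h1 := (h k).1
      rw [← h.iterate_eq ha k] at h1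
      exact h1.le

theorem mem_X_W (hz : z ∈ X) : W z ∈ X :=
  ⟨fun k => hz.1 (k + 1), hz.2.comp (tendsto_add_atTop_nat 1)⟩

/-- By `abs_lt_of_mem_X` every iterate is inside the wedge, and the sign selects the half.
Contraction keeps the height positive and at most `a`, so the argument repeats. -/
theorem follows_of_mem_X (hz : z ∈ X) (hy : 0 < z.2) (hya : z.2 ≤ a) (ha : a ≤ 1 / 100000) :
    Follows a (signSeq z) z := by
  have hX : ∀ k, W^[k] z ∈ X := by
    intro k
    induction k with
    | zero => exact hz
    | succ k ih => rw [Function.iterate_succ_apply']; exact mem_X_W ih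
  have hside : ∀ k, 0 < (W^[k] z).2 → (W^[k] z).2 ≤ a →
      W^[k] z ∈ side (sgn (signSeq z k)) a ∧ sgn (signSeq z k) * ((W^[k] z).1 - 2) < 0 := by
    intro k h1 h2
    have hne : W^[k] z ≠ p0 := fun h => by rw [h] at h1; exact lt_irrefl _ h1
    have hlt := abs_lt.1 (abs_lt_of_mem_X (hX k) h1.le (h2.trans ha) hne)
    have hne2 : (W^[k] z).1 ≠ 2 := fun h => hne ((hz.1 k).2 h)
    have hneg : sgn (signSeq z k) * ((W^[k] z).1 - 2) < 0 := by
      unfold signSeq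
      split_ifs with hR
      · have : (W^[k] z).1 < 2 := lt_of_le_of_ne hR.2 hne2
        simp [sgn]; linarith
      · have : 2 < (W^[k] z).1 := by
          by_contra! hle
          exact hR ⟨(hz.1 k).1, hle⟩
        simp [sgn]; linarith
    refine ⟨⟨h1, h2, hneg.le, ?_⟩, hneg⟩
    rcases sgn_eq (signSeq z k) with e1 | e1 <;> rw [e1] <;> linarith [hlt.1, hlt.2]
  have hmain : ∀ k, W^[k] z = itin (signSeq z) z k ∧ 0 < (W^[k] z).2 ∧ (W^[k] z).2 ≤ a := by
    intro k
    induction k with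
    | zero => exact ⟨rfl, hy, hya⟩
    | succ k ih =>
      obtain ⟨i1, i2, i3⟩ := ih
      obtain ⟨h1, h2⟩ := hside k i2 i3
      have h3 := branch_snd_bounds (sgn_eq _) (side_mono ha h1)
      rw [Function.iterate_succ_apply', W_eq_branch (sgn_eq _) h2]
      refine ⟨by rw [i1, itin], h3.1, by linarith [h3.2]⟩
  intro k
  rw [← (hmain k).1]
  exact (hside k (hmain k).2.1 (hmain k).2.2).1

theorem p0_mem_X : p0 ∈ X := by
  have hW : W p0 = p0 := by
    rw [W, if_pos (show p0.1 ≤ 2 from le_rfl)]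
    simp [WPlus, shiftStep, p0, omegaPlus, disc]
    norm_num
  have hit : ∀ k, W^[k] p0 = p0 := fun k => Function.iterate_fixed hW k
  refine ⟨fun k => ?_, ?_⟩
  · rw [hit k]
    exact ⟨by simp [R, p0], fun _ => rfl⟩
  · simp only [hit]; exact tendsto_const_nhds

/-! ### Uniqueness by expansion -/

theorem itin_cone {z' : ℝ × ℝ} {n : ℕ}
    (h : ∀ j < n, itin s z j ∈ side (sgn (s j)) (1 / 100000))
    (h' : ∀ j < n, itin s z' j ∈ side (sgn (s j)) (1 / 100000))
    (hx : z.1 ≤ z'.1) (hy : |z'.2 - z.2| ≤ 1 / 1000 * (z'.1 - z.1)) :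
    (21 / 20) ^ n * (z'.1 - z.1) ≤ (itin s z' n).1 - (itin s z n).1 ∧
      |(itin s z' n).2 - (itin s z n).2| ≤ 1 / 1000 * ((itin s z' n).1 - (itin s z n).1) := by
  induction n with
  | zero => exact ⟨by simp [itin], hy⟩
  | succ n ih =>
    obtain ⟨i1, i2⟩ := ih (fun j hj => h j (by omega)) fun j hj => h' j (by omega)
    have h0 : 0 ≤ (21 / 20 : ℝ) ^ n * (z'.1 - z.1) := mul_nonneg (by positivity) (by linarith)
    obtain ⟨c1, c2⟩ := branch_cone (sgn_eq (s n)) (h n (by omega)) (h' n (by omega))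
      (by linarith) i2
    refine ⟨?_, c2⟩
    rw [pow_succ, itin, itin]
    linarith

/-- The separation grows by `21/20` at each step, yet at time `n` both points lie in a half wedge of
width less than 1. -/
theorem abs_fst_sub_le {z' : ℝ × ℝ} {n : ℕ}
    (h : ∀ j ≤ n, itin s z j ∈ side (sgn (s j)) (1 / 100000))
    (h' : ∀ j ≤ n, itin s z' j ∈ side (sgn (s j)) (1 / 100000))
    (hy : |z'.2 - z.2| ≤ 1 / 1000 * |z'.1 - z.1|) : |z'.1 - z.1| ≤ (20 / 21) ^ n := by
  wlog hx : z.1 ≤ z'.1 generalizing z z'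
  · rw [abs_sub_comm]
    rw [abs_sub_comm, abs_sub_comm z'.1] at hy
    exact this h' h hy (le_of_not_ge hx)
  rw [abs_of_nonneg (sub_nonneg.2 hx)] at hy ⊢
  have h1 := (itin_cone (fun j hj => h j hj.le) (fun j hj => h' j hj.le) hx hy).1
  have b1 := side_bounds (sgn_eq _) (h n le_rfl)
  have b2 := side_bounds (sgn_eq _) (h' n le_rfl)
  have h2 : (21 / 20 : ℝ) ^ n * (z'.1 - z.1) ≤ 1 := by linarith [b1.2, b2.2]
  have h3 : (20 / 21 : ℝ) ^ n * (21 / 20) ^ n = 1 := by rw [← mul_pow]; norm_num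
  calc z'.1 - z.1 = (20 / 21 : ℝ) ^ n * ((21 / 20) ^ n * (z'.1 - z.1)) := by
        rw [← mul_assoc, h3, one_mul]
    _ ≤ (20 / 21 : ℝ) ^ n * 1 := by gcongr
    _ = _ := mul_one _

theorem Follows.eq_of_flat {z' : ℝ × ℝ} (h : Follows a s z) (h' : Follows a s z')
    (ha : a ≤ 1 / 100000) (hy : |z'.2 - z.2| ≤ 1 / 1000 * |z'.1 - z.1|) : z = z' := by
  have h1 : ∀ n, |z'.1 - z.1| ≤ (20 / 21) ^ n := fun n =>
    abs_fst_sub_le (fun j _ => side_mono ha (h j)) (fun j _ => side_mono ha (h' j)) hy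
  have h2 : |z'.1 - z.1| ≤ 0 := ge_of_tendsto'
    (tendsto_pow_atTop_nhds_zero_of_lt_one (by norm_num) (by norm_num)) h1
  have h3 : |z'.2 - z.2| ≤ 0 := by linarith
  exact Prod.ext (by linarith [abs_nonpos_iff.1 h2]) (by linarith [abs_nonpos_iff.1 h3])

/-! ### Stretching of flat arcs -/

theorem lipschitzOnWith_iff_abs {L : ℝ≥0} {f : ℝ → ℝ} {t : Set ℝ} :
    LipschitzOnWith L f t ↔ ∀ x ∈ t, ∀ y ∈ t, |f x - f y| ≤ L * |x - y| := by
  simp only [lipschitzOnWith_iff_dist_le_mul, Real.dist_eq]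

theorem abs_sub_le_of_lipschitz {f : ℝ → ℝ} {t : Set ℝ} (hf : LipschitzOnWith (1 / 1000) f t)
    {x y : ℝ} (hx : x ∈ t) (hy : y ∈ t) : |f x - f y| ≤ 1 / 1000 * |x - y| := by
  simpa using lipschitzOnWith_iff_abs.1 hf x hx y hy

/-- In the wedge `|y - x| ≤ 10 * (|f x| + |f y|)`, so by flatness the heights differ by at most a
hundredth of that sum of absolute values. This also forbids a change of sign. -/
theorem IsFlatArc.le_mul {a : ℝ} {f : ℝ → ℝ} {l r x y : ℝ} (h : IsFlatArc (1 / 1000) a f l r)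
    (hx : x ∈ Icc l r) (hy : y ∈ Icc l r) (hx0 : 0 < f x) : 0 < f y ∧ f y ≤ 2 * f x := by
  have h1 := abs_sub_le_of_lipschitz h.2.1 hy hx
  have hwx : |x - 2| / 10 ≤ |f x| := (h.2.2 ⟨x, hx, rfl⟩).2
  have hwy : |y - 2| / 10 ≤ |f y| := (h.2.2 ⟨y, hy, rfl⟩).2
  have h2 : |y - x| ≤ |y - 2| + |x - 2| := by
    have : y - x = (y - 2) - (x - 2) := by ring
    rw [this]; exact abs_sub _ _
  have h3 := abs_le.1 h1
  rw [abs_of_pos hx0] at hwx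
  rcases abs_cases (f y) with ⟨h4, h5⟩ | ⟨h4, h5⟩ <;> constructor <;> linarith [h3.1, h3.2]

theorem IsFlatArc.mem_side {a e : ℝ} {f : ℝ → ℝ} {l r x y : ℝ} (he : e = 1 ∨ e = -1)
    (h : IsFlatArc (1 / 1000) a f l r)
    (hx : x ∈ Icc l r) (hx0 : 0 < f x) (hy : y ∈ Icc l r) (hs : e * (y - 2) ≤ 0) :
    (y, f y) ∈ side e a := by
  have h1 := (h.le_mul hx hy hx0).1
  obtain ⟨h2, h3⟩ : |f y| ≤ a ∧ |y - 2| / 10 ≤ |f y| := h.2.2 ⟨y, hy, rfl⟩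
  rw [abs_of_pos h1] at h2 h3
  refine ⟨h1, h2, hs, ?_⟩
  simp only
  have h4 := abs_le.1 (le_refl |y - 2|)
  rcases he with rfl | rfl <;> linarith [h4.1, h4.2]

theorem IsFlatArc.mono {L : ℝ≥0} {a : ℝ} {f : ℝ → ℝ} {l r l' r' : ℝ} (h : IsFlatArc L a f l r)
    (hl : l ≤ l') (hr : r' ≤ r) (hlr : l' ≤ r') : IsFlatArc L a f l' r' :=
  ⟨hlr, h.2.1.mono (Icc_subset_Icc hl hr), (image_mono (Icc_subset_Icc hl hr)).trans h.2.2⟩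

theorem stretchedBy_branch {a e : ℝ} (he : e = 1 ∨ e = -1) (ha : a ≤ 1 / 100000) {f : ℝ → ℝ}
    {l r : ℝ} (hf : IsFlatArc (1 / 1000) a f l r) (hs : ∀ x ∈ Icc l r, (x, f x) ∈ side e a)
    (hl : (branch e (l, f l)).1 - 2 < -(10 * (branch e (l, f l)).2))
    (hr : 10 * (branch e (r, f r)).2 < (branch e (r, f r)).1 - 2) :
    StretchedBy (branch e) (1 / 1000) a f l r := by
  have hlr : l ≤ r := hf.1
  set A : ℝ → ℝ := fun x => (branch e (x, f x)).1 with hA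
  set B : ℝ → ℝ := fun x => (branch e (x, f x)).2 with hB
  have hs' : ∀ x ∈ Icc l r, (x, f x) ∈ side e (1 / 100000) := fun x hx => side_mono ha (hs x hx)
  have hcone : ∀ x ∈ Icc l r, ∀ x' ∈ Icc l r, x ≤ x' →
      21 / 20 * (x' - x) ≤ A x' - A x ∧ |B x' - B x| ≤ 1 / 1000 * (A x' - A x) := by
    intro x hx x' hx' hxx
    refine branch_cone he (hs' x hx) (hs' x' hx') hxx ?_
    have := abs_sub_le_of_lipschitz hf.2.1 hx' hx
    rwa [abs_of_nonneg (sub_nonneg.2 hxx)] at this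
  have hcont : ContinuousOn (fun x => branch e (x, f x)) (Icc l r) :=
    (continuousOn_branch he).comp (continuousOn_id.prodMk hf.2.1.continuousOn) hs'
  have hAc : ContinuousOn A (Icc l r) := continuous_fst.comp_continuousOn hcont
  have hBc : ContinuousOn B (Icc l r) := continuous_snd.comp_continuousOn hcont
  have hBp : ∀ x ∈ Icc l r, 0 < B x ∧ B x ≤ 1 / 100 * f x := fun x hx =>
    branch_snd_bounds he (hs' x hx)
  have hll : l ∈ Icc l r := left_mem_Icc.2 hlr
  have hrr : r ∈ Icc l r := right_mem_Icc.2 hlr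
  have hl' : A l - 2 < -(10 * B l) := hl
  have hr' : 10 * B r < A r - 2 := hr
  -- The image starts left of the wedge and ends right of it, so it meets both faces. Expansion
  -- makes `A` injective, and `φ` inverts it between these two crossings.
  obtain ⟨u, hu, hu0⟩ : ∃ u ∈ Icc l r, A u - 2 + 10 * B u = 0 :=
    intermediate_value_Icc (f := fun x => A x - 2 + 10 * B x) hlr
      ((hAc.sub continuousOn_const).add (hBc.const_mul 10))
      ⟨by linarith, by linarith [(hBp r hrr).1]⟩
  obtain ⟨v, hv, hv0⟩ : ∃ v ∈ Icc l r, A v - 2 - 10 * B v = 0 :=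
    intermediate_value_Icc (f := fun x => A x - 2 - 10 * B x) hlr
      ((hAc.sub continuousOn_const).sub (hBc.const_mul 10))
      ⟨by linarith [(hBp l hll).1], by linarith⟩
  have hBu := hBp u hu
  have hBv := hBp v hv
  have huv : u ≤ v := by
    by_contra! hlt
    have := (hcone v hv u hu hlt.le).1
    linarith
  have hAuv : A u ≤ A v := by linarith
  have hsub : Icc u v ⊆ Icc l r := Icc_subset_Icc hu.1 hv.2
  have hinv : ∀ t ∈ Icc (A u) (A v), ∃ x ∈ Icc u v, A x = t := fun t ht =>
    intermediate_value_Icc huv (hAc.mono hsub) ht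
  choose! φ hφ hAφ using hinv
  have hinj : ∀ x ∈ Icc l r, ∀ x' ∈ Icc l r, A x = A x' → x = x' := by
    intro x hx x' hx' hxx
    rcases le_total x x' with h | h
    · have := (hcone x hx x' hx' h).1
      linarith
    · have := (hcone x' hx' x hx h).1
      linarith
  have himg : ∀ t ∈ Icc (A u) (A v), branch e (φ t, f (φ t)) = (t, B (φ t)) := fun t ht =>
    Prod.ext (hAφ t ht) rfl
  have hAul : A u ∈ Icc (A u) (A v) := left_mem_Icc.2 hAuv
  have hAvr : A v ∈ Icc (A u) (A v) := right_mem_Icc.2 hAuv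
  have hφu : φ (A u) = u := hinj _ (hsub (hφ _ hAul)) u hu (hAφ _ hAul)
  have hφv : φ (A v) = v := hinj _ (hsub (hφ _ hAvr)) v hv (hAφ _ hAvr)
  have hfa : ∀ x ∈ Icc l r, f x ≤ a := fun x hx => (hs x hx).2.1
  have hf0 : ∀ x ∈ Icc l r, 0 < f x := fun x hx => (hs x hx).1
  have hLip : LipschitzOnWith (1 / 1000) (fun t => B (φ t)) (Icc (A u) (A v)) := by
    rw [lipschitzOnWith_iff_abs]
    push_cast
    intro t ht t' ht'
    have h1 := hsub (hφ t ht)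
    have h2 := hsub (hφ t' ht')
    rcases le_total (φ t) (φ t') with h | h
    · have := (hcone _ h1 _ h2 h).2
      rw [hAφ t ht, hAφ t' ht', abs_sub_comm] at this
      exact this.trans (by gcongr; rw [abs_sub_comm]; exact le_abs_self _)
    · have := (hcone _ h2 _ h1 h).2
      rw [hAφ t ht, hAφ t' ht'] at this
      exact this.trans (by gcongr; exact le_abs_self _)
  refine ⟨fun t => B (φ t), A u, A v, ⟨hAuv, hLip, ?_⟩, ?_, ?_, ?_, ?_, u, hu, v, hv, ?_, ?_,
    21 / 20, by norm_num, fun x hx x' hx' hxx => (hcone x (hsub hx) x' (hsub hx') hxx).1⟩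
  · rintro _ ⟨t, ht, rfl⟩
    have hxt := hφ t ht
    have c1 := (hcone u hu (φ t) (hsub hxt) hxt.1)
    have c2 := (hcone (φ t) (hsub hxt) v hv hxt.2)
    have c1' := abs_le.1 c1.2
    have c2' := abs_le.1 c2.2
    rw [hAφ t ht] at c1 c2 c1' c2'
    have hb := hBp _ (hsub hxt)
    refine ⟨?_, ?_⟩
    · simp only
      rw [abs_of_pos hb.1]
      linarith [hfa _ (hsub hxt), hf0 _ (hsub hxt)]
    · simp only
      rw [abs_of_pos hb.1, div_le_iff₀ (by norm_num), abs_le]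
      constructor <;> linarith [c1'.1, c1'.2, c2'.1, c2'.2, ht.1, ht.2]
  · simp only [hφu]
    exact ⟨hBu.1, show B u ≤ a by linarith [hfa u hu, hf0 u hu],
      show A u = 2 - 10 * B u by linarith⟩
  · simp only [hφv]
    exact ⟨hBv.1, show B v ≤ a by linarith [hfa v hv, hf0 v hv],
      show A v = 2 + 10 * B v by linarith⟩
  · rintro _ ⟨t, ht, rfl⟩
    exact ⟨_, ⟨φ t, hsub (hφ t ht), rfl⟩, himg t ht⟩
  · rintro _ ⟨t, ht, rfl⟩ _ ⟨x, hx, rfl⟩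
    have h1 := hBp _ (hsub (hφ t ht))
    have h2 := (hf.le_mul hx (hsub (hφ t ht)) (hf0 x hx)).2
    have h3 := hf0 x hx
    simp only
    linarith
  · simp only [hφu]; rfl
  · simp only [hφv]; rfl

theorem stretchesArcs {a : ℝ} (ha : a ≤ 1 / 100000) : StretchesArcs (1 / 1000) a := by
  constructor
  · intro f l hf hl
    obtain ⟨hl1, -, hl3⟩ := hl
    simp only at hl1 hl3
    have hll : l ∈ Icc l 2 := left_mem_Icc.2 hf.1
    have hs : ∀ x ∈ Icc l 2, (x, f x) ∈ side 1 a := fun x hx =>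
      hf.mem_side (Or.inl rfl) hll hl1 hx (by linarith [hx.2])
    rw [WPlus_eq]
    refine stretchedBy_branch (Or.inl rfl) ha hf hs ?_ ?_
    · have := branch_exit_face (Or.inl rfl) (side_mono ha (hs l hll)) (by linarith)
      linarith
    · have := branch_exit_line (Or.inl rfl) (side_mono ha (hs 2 (right_mem_Icc.2 hf.1)))
      linarith
  · intro f r hf hr
    obtain ⟨hr1, -, hr3⟩ := hr
    simp only at hr1 hr3
    have hrr : r ∈ Icc 2 r := right_mem_Icc.2 hf.1
    have hs : ∀ x ∈ Icc 2 r, (x, f x) ∈ side (-1) a := fun x hx =>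
      hf.mem_side (Or.inr rfl) hrr hr1 hx (by linarith [hx.1])
    rw [WMinus_eq]
    refine stretchedBy_branch (Or.inr rfl) ha hf hs ?_ ?_
    · have := branch_exit_line (Or.inr rfl) (side_mono ha (hs 2 (left_mem_Icc.2 hf.1)))
      linarith
    · have := branch_exit_face (Or.inr rfl) (side_mono ha (hs r hrr)) (by linarith)
      linarith

/-! ### Existence of points with a prescribed itinerary -/

/-- The arc and the sequence vary in the induction: the stretched image is a crossing arc, to which
the case `n` applies with the shifted sequence; the point found is then pulled back. -/
theorem exists_follows_lt {a : ℝ} (ha : a ≤ 1 / 100000) (n : ℕ) :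
    ∀ (s : ℕ → ℤˣ) (f : ℝ → ℝ) (l r : ℝ), IsFlatArc (1 / 1000) a f l r →
      (l, f l) ∈ faceNW a → (r, f r) ∈ faceNE a →
      ∃ x ∈ Icc l r, ∀ j < n, itin s (x, f x) j ∈ side (sgn (s j)) a := by
  induction n with
  | zero => exact fun s f l r hf _ _ => ⟨l, left_mem_Icc.2 hf.1, fun j hj => absurd hj (by omega)⟩
  | succ n ih =>
    intro s f l r hf hl hr
    obtain ⟨l', r', hll, hrr, hs, hst⟩ : ∃ l' r', l ≤ l' ∧ r' ≤ r ∧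
        (∀ x ∈ Icc l' r', (x, f x) ∈ side (sgn (s 0)) a) ∧
        StretchedBy (branch (sgn (s 0))) (1 / 1000) a f l' r' := by
      have hl2 : l ≤ 2 := by linarith [hl.1, hl.2.2]
      have hr2 : 2 ≤ r := by linarith [hr.1, hr.2.2]
      rcases Int.units_eq_one_or (s 0) with h0 | h0
      · have hf' := hf.mono le_rfl hr2 hl2
        have h1 : sgn (s 0) = 1 := by simp [sgn, h0]
        refine ⟨l, 2, le_rfl, hr2, fun x hx => ?_, ?_⟩
        · rw [h1]
          exact hf'.mem_side (Or.inl rfl) (left_mem_Icc.2 hl2) hl.1 hx (by linarith [hx.2])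
        · rw [h1, ← WPlus_eq]
          exact (stretchesArcs ha).1 f l hf' hl
      · have hf' := hf.mono hl2 le_rfl hr2
        have h1 : sgn (s 0) = -1 := by simp [sgn, h0]
        refine ⟨2, r, hl2, le_rfl, fun x hx => ?_, ?_⟩
        · rw [h1]
          exact hf'.mem_side (Or.inr rfl) (right_mem_Icc.2 hr2) hr.1 hx (by linarith [hx.1])
        · rw [h1, ← WMinus_eq]
          exact (stretchesArcs ha).2 f r hf' hr
    obtain ⟨g, p, q, hg, hgl, hgr, himg, -⟩ := hst
    obtain ⟨t, ht, hjt⟩ := ih (fun k => s (k + 1)) g p q hg hgl hgr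
    obtain ⟨_, ⟨x, hx, rfl⟩, hxt⟩ := himg ⟨t, ht, rfl⟩
    refine ⟨x, Icc_subset_Icc hll hrr hx, fun j hj => ?_⟩
    cases j with
    | zero => exact hs x hx
    | succ j =>
      rw [itin_succ_eq, hxt]
      exact hjt j (by omega)

/-- The half wedge fails to be closed only at the apex, hence the separate positivity of the limit
height. -/
theorem mem_side_of_tendsto {a e : ℝ} {u : ℕ → ℝ × ℝ} {p : ℝ × ℝ} (hu : Tendsto u atTop (𝓝 p))
    (hs : ∀ᶠ n in atTop, u n ∈ side e a) (hp : 0 < p.2) : p ∈ side e a := by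
  have h1 : Tendsto (fun n => (u n).1) atTop (𝓝 p.1) := (continuous_fst.tendsto p).comp hu
  have h2 : Tendsto (fun n => (u n).2) atTop (𝓝 p.2) := (continuous_snd.tendsto p).comp hu
  have h3 := (h1.sub_const 2).const_mul e
  exact ⟨hp, le_of_tendsto h2 (hs.mono fun n hn => hn.2.1),
    le_of_tendsto h3 (hs.mono fun n hn => hn.2.2.1),
    le_of_tendsto_of_tendsto (h2.const_mul 10).neg h3 (hs.mono fun n hn => hn.2.2.2)⟩

theorem exists_follows {a : ℝ} (ha : a ≤ 1 / 100000) (s : ℕ → ℤˣ) {f : ℝ → ℝ} {l r : ℝ}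
    (hf : IsFlatArc (1 / 1000) a f l r) (hl : (l, f l) ∈ faceNW a) (hr : (r, f r) ∈ faceNE a) :
    ∃ x ∈ Icc l r, Follows a s (x, f x) := by
  choose x hx hxs using fun n => exists_follows_lt ha n s f l r hf hl hr
  obtain ⟨c, hc, φ, hφ, hlim⟩ := isCompact_Icc.tendsto_subseq hx
  have hf0 : 0 < f c := (hf.le_mul (left_mem_Icc.2 hf.1) hc hl.1).1
  have hs : ∀ k, ∀ᶠ n in atTop, itin s (x (φ n), f (x (φ n))) k ∈ side (sgn (s k)) a := by
    intro k
    filter_upwards [eventually_gt_atTop k] with n hn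
    exact hxs (φ n) k (hn.trans_le (hφ.id_le n))
  -- Convergence and membership must be proved together: membership at time `k` gives continuity of
  -- the branch there and positive height at time `k + 1`.
  have hmain : ∀ k, Tendsto (fun n => itin s (x (φ n), f (x (φ n))) k) atTop
      (𝓝 (itin s (c, f c) k)) ∧ itin s (c, f c) k ∈ side (sgn (s k)) a := by
    intro k
    induction k with
    | zero =>
      have h0 : Tendsto (fun n => itin s (x (φ n), f (x (φ n))) 0) atTop
          (𝓝 (itin s (c, f c) 0)) := by
        refine hlim.prodMk_nhds ?_
        exact (hf.2.1.continuousOn c hc).tendsto.comp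
          (tendsto_nhdsWithin_iff.2 ⟨hlim, Eventually.of_forall fun n => hx _⟩)
      exact ⟨h0, mem_side_of_tendsto h0 (hs 0) hf0⟩
    | succ k ih =>
      have hk := side_mono ha ih.2
      have h0 : Tendsto (fun n => itin s (x (φ n), f (x (φ n))) (k + 1)) atTop
          (𝓝 (itin s (c, f c) (k + 1))) :=
        (continuousOn_branch (sgn_eq (s k)) _ hk).tendsto.comp
          (tendsto_nhdsWithin_iff.2 ⟨ih.1, (hs k).mono fun n hn => side_mono ha hn⟩)
      exact ⟨h0, mem_side_of_tendsto h0 (hs (k + 1)) (branch_snd_bounds (sgn_eq _) hk).1⟩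
  exact ⟨c, hc, fun k => (hmain k).2⟩

/-! ### Cantor sets in crossing arcs -/

/-- A Cantor space of sign sequences, continuously embedded in an arc, is a Cantor set in it. -/
theorem isCantorSetIn_range {ψ : (ℕ → ℤˣ) → ℝ × ℝ} (hψ : Continuous ψ)
    (hinj : Function.Injective ψ) {f : ℝ → ℝ} {l r : ℝ} (hlr : l < r)
    (hf : ContinuousOn f (Icc l r)) (hsub : range ψ ⊆ arc f l r) :
    IsCantorSetIn (range ψ) (arc f l r) := by
  have hemb : IsClosedEmbedding ψ := hψ.isClosedEmbedding hinj
  have hclosed : IsClosed (range ψ) := hemb.isClosed_range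
  refine ⟨hsub, range_nonempty ψ, hclosed.preimage continuous_subtype_val, ?_, ?_⟩
  · rw [eq_empty_iff_forall_notMem]
    rintro ⟨_, x, hx, rfl⟩ hz
    obtain ⟨U, hU, hUsub⟩ := mem_nhds_subtype _ _ _ |>.1 (mem_interior_iff_mem_nhds.1 hz)
    have hg : ContinuousOn (fun t => (t, f t)) (Icc l r) := continuousOn_id.prodMk hf
    have hpre := (hg x hx).preimage_mem_nhdsWithin hU
    obtain ⟨ε, hε, hball⟩ := Metric.mem_nhdsWithin_iff.1 hpre
    set J := Metric.ball x ε ∩ Icc l r with hJ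
    have hJimg : (fun t => (t, f t)) '' J ⊆ range ψ := by
      rintro _ ⟨t, ht, rfl⟩
      have : (⟨(t, f t), t, ht.2, rfl⟩ : arc f l r) ∈ (↑) ⁻¹' (range ψ) := hUsub (hball ht)
      exact this
    -- An interior point would put the image of an interval inside a totally disconnected set,
    -- reducing it to one point.
    have hJc : IsPreconnected J := by
      rw [hJ, Real.ball_eq_Ioo]
      exact (ordConnected_Ioo.inter ordConnected_Icc).isPreconnected
    have htd : IsTotallyDisconnected (range ψ) :=
      hemb.isEmbedding.isTotallyDisconnected_range.2 inferInstance
    have hss := htd _ hJimg (hJc.image _ (hg.mono inter_subset_right))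
    have hxJ : x ∈ J := ⟨Metric.mem_ball_self hε, hx⟩
    obtain ⟨t, ht, hne⟩ : ∃ t ∈ J, t ≠ x := by
      rcases lt_or_ge x r with h | h
      · obtain ⟨t, h1, h2⟩ := exists_between (lt_min h (lt_add_of_pos_right x hε))
        refine ⟨t, ⟨?_, by linarith [hx.1], (h2.trans_le (min_le_left _ _)).le⟩, h1.ne'⟩
        rw [Real.ball_eq_Ioo]
        exact ⟨by linarith, h2.trans_le (min_le_right _ _)⟩
      · have h' : l < x := hlr.trans_le h
        obtain ⟨t, h1, h2⟩ := exists_between (max_lt h' (sub_lt_self x hε))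
        refine ⟨t, ⟨?_, ((le_max_left _ _).trans_lt h1).le, by linarith [hx.2]⟩, h2.ne⟩
        rw [Real.ball_eq_Ioo]
        exact ⟨(le_max_right _ _).trans_lt h1, by linarith⟩
    exact hne (congrArg Prod.fst (hss ⟨t, ht, rfl⟩ ⟨x, hxJ, rfl⟩))
  · rintro _ ⟨s, rfl⟩
    rw [accPt_iff_nhds]
    intro U hU
    -- Flipping only the `n`-th sign gives sequences different from `s` that converge to `s`.
    have hflip : Tendsto (fun n => Function.update s n (-s n)) atTop (𝓝 s) := by
      rw [tendsto_pi_nhds]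
      intro k
      refine tendsto_const_nhds.congr' ?_
      filter_upwards [eventually_gt_atTop k] with n hn
      rw [Function.update_of_ne hn.ne]
    obtain ⟨n, hn⟩ := (((hψ.tendsto s).comp hflip).eventually hU).exists
    refine ⟨_, ⟨hn, mem_range_self _⟩, fun h => ?_⟩
    have h1 : Function.update s n (-s n) n = s n := congrFun (hinj h) n
    rw [Function.update_self] at h1
    rcases Int.units_eq_one_or (s n) with h2 | h2 <;> rw [h2] at h1 <;>
      exact absurd h1 (by decide)

theorem follows_iff {a : ℝ} (ha : a ≤ 1 / 100000) {s : ℕ → ℤˣ} {z : ℝ × ℝ} (hy : 0 < z.2)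
    (hya : z.2 ≤ a) : z ∈ X ∧ signSeq z = s ↔ Follows a s z :=
  ⟨fun h => h.2 ▸ follows_of_mem_X h.1 hy hya ha, fun h => ⟨h.mem_X ha, h.signSeq_eq ha⟩⟩

theorem cantor_of_isFlatArc {a : ℝ} (ha : a ≤ 1 / 100000) {f : ℝ → ℝ} {l r : ℝ}
    (hf : IsFlatArc (1 / 1000) a f l r) (hl : (l, f l) ∈ faceNW a) (hr : (r, f r) ∈ faceNE a) :
    IsCantorSetIn (X ∩ arc f l r) (arc f l r) ∧ BijOn signSeq (X ∩ arc f l r) univ := by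
  have hpos : ∀ x ∈ Icc l r, 0 < f x ∧ f x ≤ a := by
    intro x hx
    have h1 := (hf.le_mul (left_mem_Icc.2 hf.1) hx hl.1).1
    have h2 : |f x| ≤ a := (hf.2.2 ⟨x, hx, rfl⟩).1
    exact ⟨h1, (le_abs_self _).trans h2⟩
  choose φ hφ hφs using fun s => exists_follows ha s hf hl hr
  have hflat : ∀ x ∈ Icc l r, ∀ x' ∈ Icc l r, |f x' - f x| ≤ 1 / 1000 * |x' - x| :=
    fun x hx x' hx' => abs_sub_le_of_lipschitz hf.2.1 hx' hx
  have huniq : ∀ x ∈ Icc l r, (x, f x) ∈ X → φ (signSeq (x, f x)) = x := by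
    intro x hx hX
    have h1 := follows_of_mem_X hX (hpos x hx).1 (hpos x hx).2 ha
    exact congrArg Prod.fst ((hφs _).eq_of_flat h1 ha (hflat _ (hφ _) x hx))
  have hsign : ∀ s, signSeq (φ s, f (φ s)) = s := fun s => (hφs s).signSeq_eq ha
  -- Agreement of the signs up to time `n` puts the two points within `(20/21)^n` horizontally.
  have hφc : Continuous φ := by
    rw [continuous_iff_continuousAt]
    intro s
    rw [ContinuousAt, Metric.tendsto_nhds]
    intro ε hε
    obtain ⟨n, hn⟩ := exists_pow_lt_of_lt_one hε (by norm_num : (20 / 21 : ℝ) < 1)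
    have hnear : ∀ᶠ t in 𝓝 s, ∀ j ∈ Finset.range (n + 1), t j = s j := by
      rw [Filter.eventually_all_finset]
      intro j _
      exact ((isOpen_discrete {s j}).preimage
        (continuous_apply (A := fun _ : ℕ => ℤˣ) j)).mem_nhds rfl
    filter_upwards [hnear] with t ht
    have ht' : ∀ j ≤ n, s j = t j := fun j hj => (ht j (Finset.mem_range.2 (by omega))).symm
    have h1 : ∀ j ≤ n, itin s (φ t, f (φ t)) j ∈ side (sgn (s j)) (1 / 100000) := by
      intro j hj
      rw [itin_congr (t := t) fun i hi => ht' i (by omega), ht' j hj]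
      exact side_mono ha (hφs t j)
    rw [Real.dist_eq]
    exact (abs_fst_sub_le (fun j _ => side_mono ha (hφs s j)) h1
      (hflat _ (hφ s) _ (hφ t))).trans_lt hn
  have hψc : Continuous fun s => (φ s, f (φ s)) :=
    hφc.prodMk (hf.2.1.continuousOn.comp_continuous hφc hφ)
  have hrange : range (fun s => (φ s, f (φ s))) = X ∩ arc f l r := by
    ext z
    constructor
    · rintro ⟨s, rfl⟩
      exact ⟨(hφs s).mem_X ha, φ s, hφ s, rfl⟩
    · rintro ⟨hX, x, hx, rfl⟩
      exact ⟨signSeq (x, f x), by simp only [huniq x hx hX]⟩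
  constructor
  · rw [← hrange]
    refine isCantorSetIn_range hψc (fun s t h => ?_) ?_ hf.2.1.continuousOn ?_
    · rw [← hsign s, ← hsign t]; exact congrArg signSeq h
    · linarith [hl.1, hl.2.2, hr.1, hr.2.2]
    · rw [hrange]; exact inter_subset_right
  · refine ⟨mapsTo_univ _ _, ?_, fun s _ => ⟨(φ s, f (φ s)), ?_, hsign s⟩⟩
    · rintro _ ⟨hX, x, hx, rfl⟩ _ ⟨hX', x', hx', rfl⟩ h
      have h1 := huniq x hx hX
      have h2 := huniq x' hx' hX'
      simp only at h h1 h2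
      rw [h, h2] at h1
      rw [h1]
    · rw [← hrange]; exact mem_range_self s

/-! ### The Lipschitz curves -/

theorem exists_follows_height {a y : ℝ} (ha : a ≤ 1 / 100000) (hy : 0 < y) (hya : y ≤ a)
    (s : ℕ → ℤˣ) : ∃ x, Follows a s (x, y) := by
  have hf : IsFlatArc (1 / 1000) a (fun _ => y) (2 - 10 * y) (2 + 10 * y) := by
    refine ⟨by linarith, (LipschitzWith.const' y).lipschitzOnWith, ?_⟩
    rintro _ ⟨x, hx, rfl⟩
    refine ⟨by simpa only [abs_of_pos hy] using hya, ?_⟩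
    simp only
    rw [abs_of_pos hy, div_le_iff₀ (by norm_num), abs_le]
    constructor <;> linarith [hx.1, hx.2]
  obtain ⟨x, -, hx⟩ := exists_follows ha s hf ⟨hy, hya, rfl⟩ ⟨hy, hya, rfl⟩
  exact ⟨x, hx⟩

open Classical in
/-- The abscissa at height `y` of the point of `𝒳` with sign sequence `s`. -/
def abscissa (a : ℝ) (s : ℕ → ℤˣ) (y : ℝ) : ℝ :=
  if h : ∃ x, Follows a s (x, y) then h.choose else 2

theorem follows_abscissa {a y : ℝ} (ha : a ≤ 1 / 100000) (hy : 0 < y) (hya : y ≤ a)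
    (s : ℕ → ℤˣ) : Follows a s (abscissa a s y, y) := by
  have h := exists_follows_height ha hy hya s
  rw [abscissa, dif_pos h]
  exact h.choose_spec

/-- No point of height 0 satisfies `Follows`, so the default value 2 makes every curve end at `p0`.
-/
theorem abscissa_zero (a : ℝ) (s : ℕ → ℤˣ) : abscissa a s 0 = 2 := by
  rw [abscissa, dif_neg]
  rintro ⟨x, hx⟩
  exact lt_irrefl _ (hx 0).1

theorem follows_iff_eq_abscissa {a y x : ℝ} (ha : a ≤ 1 / 100000) (hy : 0 < y) (hya : y ≤ a)
    (s : ℕ → ℤˣ) : Follows a s (x, y) ↔ x = abscissa a s y := by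
  have h := follows_abscissa ha hy hya s
  refine ⟨fun h1 => congrArg Prod.fst (h1.eq_of_flat h ha ?_), fun h1 => h1 ▸ h⟩
  simp

/-- If the bound failed at two positive heights, the two points would be in flat position with the
same signs, hence equal. At height 0 the wedge itself gives the bound. -/
theorem lipschitzOnWith_abscissa {a : ℝ} (ha : a ≤ 1 / 100000) (s : ℕ → ℤˣ) :
    LipschitzOnWith 1000 (abscissa a s) (Icc 0 a) := by
  rw [lipschitzOnWith_iff_abs]
  push_cast
  have hzero : ∀ y ∈ Ioc 0 a, |abscissa a s y - 2| ≤ 1000 * y := by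
    intro y hy
    have h1 := side_bounds (sgn_eq _) (side_mono ha (follows_abscissa ha hy.1 hy.2 s 0))
    rw [abs_le]
    constructor <;> linarith [h1.2.2, hy.1]
  intro y hy y' hy'
  rcases hy.1.eq_or_lt with h0 | h0 <;> rcases hy'.1.eq_or_lt with h0' | h0'
  · simp [← h0, ← h0']
  · rw [← h0, abscissa_zero, abs_sub_comm, zero_sub, abs_neg, abs_of_pos h0']
    exact hzero y' ⟨h0', hy'.2⟩
  · rw [← h0', abscissa_zero, sub_zero, abs_of_pos h0]
    exact hzero y ⟨h0, hy.2⟩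
  · by_contra! hlt
    have h1 := follows_abscissa ha h0 hy.2 s
    have h2 := follows_abscissa ha h0' hy'.2 s
    have h3 := h2.eq_of_flat h1 ha (by simp only; linarith)
    obtain ⟨h4, h5⟩ := Prod.mk.inj h3
    rw [h4, h5] at hlt
    simp at hlt

theorem eq_two_of_mem_X {x : ℝ} (h : (x, (0 : ℝ)) ∈ X) : x = 2 := by
  by_contra hne
  have := abs_lt_of_mem_X h le_rfl (by norm_num) fun h0 => hne (congrArg Prod.fst h0)
  simp only [mul_zero] at this
  exact absurd this (not_lt.2 (abs_nonneg _))

theorem X_inter_eq_iUnion {a : ℝ} (ha0 : 0 < a) (ha : a ≤ 1 / 100000) :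
    X ∩ {p | 0 ≤ p.2 ∧ p.2 ≤ a} = ⋃ s, sideGraph (abscissa a s) a := by
  ext ⟨x, y⟩
  simp only [mem_iUnion]
  constructor
  · rintro ⟨hX, hy, hya⟩
    simp only at hy hya
    rcases hy.eq_or_lt with rfl | hy
    -- Any sequence would do here, as all curves contain `p0`.
    · exact ⟨1, 0, ⟨le_rfl, ha0.le⟩, by simp only [abscissa_zero, eq_two_of_mem_X hX]⟩
    · have h := (follows_iff_eq_abscissa ha hy hya _).1 (follows_of_mem_X hX hy hya ha)
      exact ⟨signSeq (x, y), y, ⟨hy.le, hya⟩, by simp only [← h]⟩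
  · rintro ⟨s, t, ht, hxy⟩
    obtain ⟨rfl, rfl⟩ := Prod.mk.inj hxy
    refine ⟨?_, ht⟩
    rcases ht.1.eq_or_lt with rfl | h
    · rw [abscissa_zero]; exact p0_mem_X
    · exact (follows_abscissa ha h ht.2 s).mem_X ha

theorem sideGraph_inter {a : ℝ} (ha0 : 0 < a) (ha : a ≤ 1 / 100000) {s t : ℕ → ℤˣ} (hst : s ≠ t) :
    sideGraph (abscissa a s) a ∩ sideGraph (abscissa a t) a = {p0} := by
  ext z
  constructor
  · rintro ⟨⟨y, hy, rfl⟩, y', -, h⟩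
    obtain ⟨h1, rfl⟩ := Prod.mk.inj h
    rcases hy.1.eq_or_lt with rfl | h0
    · simp only [abscissa_zero]; rfl
    · refine absurd ?_ hst
      rw [← (follows_abscissa ha h0 hy.2 s).signSeq_eq ha,
        ← (follows_abscissa ha h0 hy.2 t).signSeq_eq ha, h1]
  · rintro rfl
    exact ⟨⟨0, ⟨le_rfl, ha0.le⟩, by simp only [abscissa_zero]; rfl⟩,
      0, ⟨le_rfl, ha0.le⟩, by simp only [abscissa_zero]; rfl⟩

end

end Wilkinson

theorem proposition5p4 :
    ∃ L : ℝ≥0, 0 < L ∧ (L : ℝ) < 1 / 6 ∧ ∃ a₀ : ℝ, 0 < a₀ ∧ a₀ ≤ 1 / 10 ∧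
      ∀ a : ℝ, 0 < a → a ≤ a₀ →
        Wilkinson.StretchesArcs L a ∧
        (∀ (f : ℝ → ℝ) (l r : ℝ), Wilkinson.IsFlatArc L a f l r →
          (l, f l) ∈ Wilkinson.faceNW a → (r, f r) ∈ Wilkinson.faceNE a →
            Wilkinson.IsCantorSetIn (Wilkinson.X ∩ Wilkinson.arc f l r) (Wilkinson.arc f l r) ∧
            Set.BijOn Wilkinson.signSeq (Wilkinson.X ∩ Wilkinson.arc f l r) Set.univ) ∧
        ∃ F : (ℕ → ℤˣ) → ℝ → ℝ,
          (∀ s, ∃ K : ℝ≥0, LipschitzOnWith K (F s) (Set.Icc 0 a)) ∧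
          (∀ s, ∀ y ∈ Set.Ioc 0 a, ∀ x : ℝ,
            ((x, y) ∈ Wilkinson.X ∧ Wilkinson.signSeq (x, y) = s) ↔ x = F s y) ∧
          Wilkinson.X ∩ {p | 0 ≤ p.2 ∧ p.2 ≤ a} = ⋃ s, Wilkinson.sideGraph (F s) a ∧
          (∀ s t, s ≠ t →
            Wilkinson.sideGraph (F s) a ∩ Wilkinson.sideGraph (F t) a = {Wilkinson.p0}) := by
  refine ⟨1 / 1000, by norm_num, by norm_num, 1 / 100000, by norm_num, by norm_num,
    fun a ha0 ha => ⟨Wilkinson.stretchesArcs ha,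
      fun f l r hf hl hr => Wilkinson.cantor_of_isFlatArc ha hf hl hr, Wilkinson.abscissa a,
      fun s => ⟨1000, Wilkinson.lipschitzOnWith_abscissa ha s⟩, fun s y hy x => ?_,
      Wilkinson.X_inter_eq_iUnion ha0 ha, fun s t hst => Wilkinson.sideGraph_inter ha0 ha hst⟩⟩
  rw [Wilkinson.follows_iff ha hy.1 hy.2, Wilkinson.follows_iff_eq_abscissa ha hy.1 hy.2]
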